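/- Let $d\ge 2$, and let $(\tau_e)_{e\in E(\mathbb Z^d)}$ be independent, identically distributed, non-negative random variables indexed by the nearest-neighbour edges of $\mathbb Z^d$. Suppose that there are constants $\beta_1,\beta_2,\alpha>0$ and $0<r\le 1$ such that, for all $t\ge 0$, $$\beta_1 e^{-\alpha t^r}\le \mathbb P(\tau_e>t)\le \beta_2 e^{-\alpha t^r}.$$ For $y,z\in\mathbb R^d$ let the first passage time be $T(y,z)=\inf_\gamma\sum_{e\in\gamma}\tau_e$, where $\gamma$ ranges over all finite nearest-neighbour paths in $\mathbb Z^d$ from $\lfloor y\rfloor$ to $\lfloor z\rfloor$, and $\lfloor\cdot\rfloor$ is the coordinatewise integer part. Let $x\in\mathbb R^d\setminus\{0\}$ and $\xi>0$. Then every $T(0,y)$, $y\in\mathbb R^d$, is integrable, the limit (the time constant) $$\mu(x)=\lim_{t\to\infty}\frac1t\,\mathbb E[T(0,tx)]$$ exists and is finite, and $$\lim_{n\to\infty}\frac{1}{n^r}\log\mathbb P\big(T(0,nx)>n(\mu(x)+\xi)\big)=-2d\alpha\,\xi^r .$$ -/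

import Mathlib

open MeasureTheory ProbabilityTheory Filter Topology

/-- The lattice `ℤ^d` with its nearest-neighbour edges: `x` and `y` are adjacent when
`|x - y|₁ = 1`. -/
def latticeGraph (d : ℕ) : SimpleGraph (Fin d → ℤ) where
  Adj x y := ∑ i, |x i - y i| = 1
  symm := ⟨fun x y h => by
    rw [← h]
    exact Finset.sum_congr rfl fun i _ => abs_sub_comm _ _⟩
  loopless := ⟨fun x h => by simp at h⟩

/-- The passage time of a finite nearest-neighbour path: the sum of the weights of the edges that
it traverses. (An edge is counted each time it is traversed; for non-negative weights this does
not affect the infimum over all paths between two given points, since loops may be erased.) -/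
noncomputable def pathTime {d : ℕ} (w : (latticeGraph d).edgeSet → ℝ) {x y : Fin d → ℤ} :
    (latticeGraph d).Walk x y → ℝ
  | .nil => 0
  | .cons (u := u) (v := v) h p => w ⟨s(u, v), h⟩ + pathTime w p

/-- The coordinatewise integer part of a point of `ℝ^d`. -/
noncomputable def latticeFloor {d : ℕ} (x : Fin d → ℝ) : Fin d → ℤ := fun i => ⌊x i⌋

/-- The first passage time `T(x, y)`, for `x, y ∈ ℝ^d`: the infimum of the passage times of all
finite paths from `⌊x⌋` to `⌊y⌋`. -/
noncomputable def passageTime {d : ℕ} (w : (latticeGraph d).edgeSet → ℝ) (x y : Fin d → ℝ) : ℝ :=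
  ⨅ p : (latticeGraph d).Walk (latticeFloor x) (latticeFloor y), pathTime w p

/-- The mean `E[T(0, x)]` of the first passage time under random edge weights `τ`. -/
noncomputable def meanPassageTime {Ω : Type*} [MeasurableSpace Ω] (P : Measure Ω) {d : ℕ}
    (τ : (latticeGraph d).edgeSet → Ω → ℝ) (x : Fin d → ℝ) : ℝ :=
  ∫ ω, passageTime (fun e => τ e ω) 0 x ∂P

/-- The time constant `μ(x) = lim_{t → ∞} E[T(0, t x)] / t`, with `t` real. -/
noncomputable def timeConstant {Ω : Type*} [MeasurableSpace Ω] (P : Measure Ω) {d : ℕ}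
    (τ : (latticeGraph d).edgeSet → Ω → ℝ) (x : Fin d → ℝ) : ℝ :=
  limUnder atTop fun t : ℝ => t⁻¹ * meanPassageTime P τ (t • x)

/-!
# Upper tail large deviations of first passage times with Weibull tails

Large values of `T(0, n x)` are caused by the edges near an endpoint. The origin has exactly `2d`
edges; if each of them is slower than `n ξ`, an event of probability about
`exp (-2 d α (n ξ) ^ r)`, then every path to `⌊n x⌋` loses the time `n ξ` at its first step.

*Lower bound* (`IIDWeights.prob_ge`). The passage time computed with the edges at the origin set to
zero is independent of those edges. Its mean is `n μ(x) - o(n)` and its second moment is `O(n²)`,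
so the second moment method bounds the probability that it exceeds `n (μ(x) - ε)` away from zero
(`IIDWeights.prob_zeroStar_ge`).

*Upper bound* (`IIDWeights.prob_le`). There are two ingredients.

* Far from the endpoints a delay is much less likely (`IIDWeights.exists_tubes`). Take `K` parallel
  tubes of constant width in direction `x`, far enough apart not to share edges, and cut each of
  them into blocks of constant length. The mean passage time of a block, even along a suitable
  finite set of paths, is nearly its length times `μ(x)`, and blocks whose indices are congruent
  modulo a constant `q` are independent. A Chernoff bound with parameter of order `n ^ (r - 1)` for
  the block times, truncated at order `n` (`exists_prob_truncated_sum_le`), shows that all `K` tubes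
  are slower than `n (μ(x) + ε)` with probability at most `C exp (-c K n ^ r)`, where `c` does not
  depend on `K`. For large `K` this is negligible.
* Let `2d` disjoint rays of constant length leave each endpoint, one through each edge, and let
  `S_i` be the total weight of the `i`-th ray at the origin and the `i`-th ray at `⌊n x⌋`. The
  `i`-th rays are joined by `K` tubes, so outside of the negligible event `T(0, n x)` is at most
  `n (μ(x) + ε) + min_i S_i`. As `r ≤ 1`, the function `t ↦ t ^ r` is subadditive, so `S_i ^ r` is
  at most the sum of `τ_e ^ r` over the edges of the `i`-th rays, and `2 d (min_i S_i) ^ r` is at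
  most the sum of `τ_e ^ r` over all rays. This is a sum of boundedly many independent variables with
  exponential moments of every order below `α` (`IIDWeights.exists_prob_rays_le`).

The time constant exists by Fekete's lemma, applied to `t ↦ E T(0, t x)`, which is subadditive up to
the error made by taking integer parts (`IIDWeights.exists_tendsto_meanPassageTime`).
-/

namespace FPP

/-! ### First passage times between lattice points -/

variable {d : ℕ}

/-- The edge set of the lattice `ℤ^d`. -/
abbrev Edge (d : ℕ) : Type := (latticeGraph d).edgeSet

/-- The first passage time between two points of `ℤ^d`. -/
noncomputable def latticeTime (w : Edge d → ℝ) (u v : Fin d → ℤ) : ℝ :=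
  ⨅ p : (latticeGraph d).Walk u v, pathTime w p

lemma passageTime_eq (w : Edge d → ℝ) (x y : Fin d → ℝ) :
    passageTime w x y = latticeTime w (latticeFloor x) (latticeFloor y) := rfl

lemma latticeFloor_zero : latticeFloor (0 : Fin d → ℝ) = 0 := by
  ext i; simp [latticeFloor]

lemma adj_iff {u v : Fin d → ℤ} : (latticeGraph d).Adj u v ↔ ∑ i, |u i - v i| = 1 := Iff.rfl

/-- Any two lattice points are joined by a path of length `|u - v|₁`. -/
lemma exists_walk_length (N : ℕ) (u v : Fin d → ℤ) (h : ∑ i, |u i - v i| = N) :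
    ∃ p : (latticeGraph d).Walk u v, p.length = N := by
  induction N generalizing u with
  | zero =>
    have h0 : ∀ i, |u i - v i| = 0 := fun i =>
      (Finset.sum_eq_zero_iff_of_nonneg (fun i _ => abs_nonneg (u i - v i))).1 (by simpa using h) i
        (Finset.mem_univ i)
    obtain rfl : u = v := by
      ext i
      have := h0 i
      rw [abs_eq_zero] at this
      linarith
    exact ⟨.nil, rfl⟩
  | succ N ih =>
    obtain ⟨j, hj⟩ : ∃ j, u j ≠ v j := by
      by_contra! hc
      simp [hc] at h
      omega
    obtain ⟨s, hs, hs'⟩ : ∃ s : ℤ, |s| = 1 ∧ |u j + s - v j| = |u j - v j| - 1 := by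
      rcases lt_or_gt_of_ne hj with h1 | h1
      · refine ⟨1, by simp, ?_⟩
        rw [abs_of_nonpos (by omega), abs_of_nonpos (by omega)]; ring
      · refine ⟨-1, by simp, ?_⟩
        rw [abs_of_nonneg (by omega), abs_of_nonneg (by omega)]; ring
    have hadj : (latticeGraph d).Adj u (Function.update u j (u j + s)) := by
      rw [adj_iff, Finset.sum_eq_single j]
      · simpa using hs
      · intro i _ hi; simp [Function.update_of_ne hi]
      · simp
    have hsum : ∑ i, |Function.update u j (u j + s) i - v i| = N := by
      rw [← Finset.add_sum_erase _ _ (Finset.mem_univ j)] at h ⊢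
      rw [Finset.sum_congr rfl (g := fun i => |u i - v i|)
        (fun i hi => by rw [Function.update_of_ne (Finset.ne_of_mem_erase hi)])]
      simp only [Function.update_self, hs']
      push_cast at h
      linarith
    obtain ⟨p, hp⟩ := ih _ hsum
    exact ⟨.cons hadj p, by simp [hp]⟩

instance (u v : Fin d → ℤ) : Nonempty ((latticeGraph d).Walk u v) := by
  obtain ⟨p, -⟩ := exists_walk_length (∑ i, |u i - v i|).toNat u v
    (Int.toNat_of_nonneg (Finset.sum_nonneg fun i _ => abs_nonneg _)).symm
  exact ⟨p⟩

instance (u v : Fin d → ℤ) : Countable ((latticeGraph d).Walk u v) :=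
  Function.Injective.countable (f := fun p => p.support) fun _ _ h =>
    SimpleGraph.Walk.ext_support h

/-- The list of edges traversed by a path, as elements of the edge set. -/
def edgeList : ∀ {u v : Fin d → ℤ}, (latticeGraph d).Walk u v → List (Edge d)
  | _, _, .nil => []
  | _, _, .cons (u := u) (v := v) h p => ⟨s(u, v), h⟩ :: edgeList p

lemma pathTime_eq_sum (w : Edge d → ℝ) {u v : Fin d → ℤ} (p : (latticeGraph d).Walk u v) :
    pathTime w p = ((edgeList p).map w).sum := by
  induction p with
  | nil => simp [pathTime, edgeList]
  | cons h p ih => simp [pathTime, edgeList, ih]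

lemma length_edgeList {u v : Fin d → ℤ} (p : (latticeGraph d).Walk u v) :
    (edgeList p).length = p.length := by
  induction p with
  | nil => simp [edgeList]
  | cons h p ih => simp [edgeList, ih]

lemma mem_support_of_mem_edgeList {u v : Fin d → ℤ} (p : (latticeGraph d).Walk u v)
    {e : Edge d} (he : e ∈ edgeList p) {y : Fin d → ℤ} (hy : y ∈ e.1) : y ∈ p.support := by
  induction p with
  | nil => simp [edgeList] at he
  | cons h p ih =>
    simp only [edgeList, List.mem_cons] at he
    rw [SimpleGraph.Walk.support_cons, List.mem_cons]
    rcases he with rfl | he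
    · rcases Sym2.mem_iff.1 hy with rfl | rfl
      · exact Or.inl rfl
      · exact Or.inr p.start_mem_support
    · exact Or.inr (ih he)

section deterministic

variable {w : Edge d → ℝ}

lemma pathTime_nonneg (hw : ∀ e, 0 ≤ w e) {u v : Fin d → ℤ} (p : (latticeGraph d).Walk u v) :
    0 ≤ pathTime w p := by
  rw [pathTime_eq_sum]
  refine List.sum_nonneg fun x hx => ?_
  obtain ⟨e, -, rfl⟩ := List.mem_map.1 hx
  exact hw e

lemma bddBelow_pathTime (hw : ∀ e, 0 ≤ w e) (u v : Fin d → ℤ) :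
    BddBelow (Set.range fun p : (latticeGraph d).Walk u v => pathTime w p) :=
  ⟨0, by rintro _ ⟨p, rfl⟩; exact pathTime_nonneg hw p⟩

lemma latticeTime_nonneg (hw : ∀ e, 0 ≤ w e) (u v : Fin d → ℤ) : 0 ≤ latticeTime w u v :=
  le_ciInf fun p => pathTime_nonneg hw p

lemma latticeTime_le_pathTime (hw : ∀ e, 0 ≤ w e) {u v : Fin d → ℤ}
    (p : (latticeGraph d).Walk u v) : latticeTime w u v ≤ pathTime w p :=
  ciInf_le (bddBelow_pathTime hw u v) p

lemma pathTime_append {u v z : Fin d → ℤ} (p : (latticeGraph d).Walk u v)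
    (q : (latticeGraph d).Walk v z) :
    pathTime w (p.append q) = pathTime w p + pathTime w q := by
  induction p with
  | nil => simp [pathTime]
  | cons h p ih => simp [pathTime, ih, add_assoc]

lemma latticeTime_triangle (hw : ∀ e, 0 ≤ w e) (u v z : Fin d → ℤ) :
    latticeTime w u z ≤ latticeTime w u v + latticeTime w v z := by
  refine le_ciInf_add_ciInf fun p q => ?_
  rw [← pathTime_append]
  exact latticeTime_le_pathTime hw _

lemma latticeTime_self (hw : ∀ e, 0 ≤ w e) (u : Fin d → ℤ) : latticeTime w u u = 0 :=
  le_antisymm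
    (by simpa [pathTime] using latticeTime_le_pathTime hw (.nil : (latticeGraph d).Walk u u))
    (latticeTime_nonneg hw u u)

lemma latticeTime_le_edge (hw : ∀ e, 0 ≤ w e) {u v : Fin d → ℤ} (h : (latticeGraph d).Adj u v) :
    latticeTime w u v ≤ w ⟨s(u, v), h⟩ := by
  simpa [pathTime] using latticeTime_le_pathTime hw (.cons h .nil)

/-- The translation of the edges of the lattice by a lattice vector. -/
def shiftEdge (a : Fin d → ℤ) (e : Edge d) : Edge d :=
  ⟨e.1.map (· + a), by
    obtain ⟨e, he⟩ := e
    induction e with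
    | h u v =>
      rw [Sym2.map_mk]
      change ∑ i, |(u + a) i - (v + a) i| = 1
      simpa using (adj_iff.1 he)⟩

lemma adj_add (a : Fin d → ℤ) {u v : Fin d → ℤ} (h : (latticeGraph d).Adj u v) :
    (latticeGraph d).Adj (u + a) (v + a) := by
  rw [adj_iff] at h ⊢
  simpa using h

lemma shiftEdge_shiftEdge (a b : Fin d → ℤ) (e : Edge d) :
    shiftEdge a (shiftEdge b e) = shiftEdge (b + a) e := by
  obtain ⟨e, he⟩ := e
  induction e with
  | h u v => simp [shiftEdge, add_assoc]

lemma shiftEdge_zero (e : Edge d) : shiftEdge 0 e = e := by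
  obtain ⟨e, he⟩ := e
  induction e with
  | h u v => simp [shiftEdge]

lemma shiftEdge_injective (a : Fin d → ℤ) : Function.Injective (shiftEdge a) :=
  Function.LeftInverse.injective (g := shiftEdge (-a)) fun e => by
    rw [shiftEdge_shiftEdge, add_neg_cancel, shiftEdge_zero]

lemma latticeTime_le_pathTime_shift (hw : ∀ e, 0 ≤ w e) (a : Fin d → ℤ) {u v : Fin d → ℤ}
    (p : (latticeGraph d).Walk u v) :
    latticeTime w (u + a) (v + a) ≤ pathTime (fun e => w (shiftEdge a e)) p := by
  induction p with
  | nil => simp [pathTime, latticeTime_self hw]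
  | @cons u v z h p ih =>
    refine (latticeTime_triangle hw _ (v + a) _).trans ?_
    exact add_le_add (latticeTime_le_edge hw (adj_add a h)) ih

lemma latticeTime_shift (hw : ∀ e, 0 ≤ w e) (a u v : Fin d → ℤ) :
    latticeTime (fun e => w (shiftEdge a e)) u v = latticeTime w (u + a) (v + a) := by
  refine le_antisymm (le_ciInf fun p => ?_)
    (le_ciInf fun p => latticeTime_le_pathTime_shift hw a p)
  have := latticeTime_le_pathTime_shift (w := fun e => w (shiftEdge a e)) (fun e => hw _) (-a) p
  simpa [shiftEdge_shiftEdge, shiftEdge_zero] using this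

lemma latticeTime_comm_le (hw : ∀ e, 0 ≤ w e) (u v : Fin d → ℤ) :
    latticeTime w u v ≤ latticeTime w v u := by
  refine le_ciInf fun p => ?_
  induction p with
  | nil => simp [pathTime, latticeTime_self hw]
  | @cons u v z h p ih =>
    refine (latticeTime_triangle hw _ v _).trans ?_
    rw [add_comm]
    refine add_le_add ?_ ih
    have := latticeTime_le_edge hw h.symm
    simpa [Sym2.eq_swap] using this

lemma latticeTime_comm (hw : ∀ e, 0 ≤ w e) (u v : Fin d → ℤ) :
    latticeTime w u v = latticeTime w v u :=
  le_antisymm (latticeTime_comm_le hw u v) (latticeTime_comm_le hw v u)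

lemma latticeTime_chain (hw : ∀ e, 0 ≤ w e) (p : ℕ → Fin d → ℤ) (n : ℕ) :
    latticeTime w (p 0) (p n) ≤ ∑ k ∈ Finset.range n, latticeTime w (p k) (p (k + 1)) := by
  induction n with
  | zero => simp [latticeTime_self hw]
  | succ n ih =>
    rw [Finset.sum_range_succ]
    exact (latticeTime_triangle hw _ (p n) _).trans (by linarith)

/-! ### Removing the edges at the origin -/

open Classical in
/-- The weights `w` with the weights of all edges at the origin replaced by `0`. -/
noncomputable def zeroStar (w : Edge d → ℝ) (e : Edge d) : ℝ :=
  if (0 : Fin d → ℤ) ∈ e.1 then 0 else w e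

lemma zeroStar_nonneg (hw : ∀ e, 0 ≤ w e) (e : Edge d) : 0 ≤ zeroStar w e := by
  unfold zeroStar; split_ifs; exacts [le_rfl, hw e]

lemma zeroStar_le (hw : ∀ e, 0 ≤ w e) (e : Edge d) : zeroStar w e ≤ w e := by
  unfold zeroStar; split_ifs; exacts [hw e, le_rfl]

lemma latticeTime_mono {w' : Edge d → ℝ} (hw : ∀ e, 0 ≤ w e) (h : ∀ e, w e ≤ w' e)
    (u v : Fin d → ℤ) : latticeTime w u v ≤ latticeTime w' u v := by
  refine le_ciInf fun p => (latticeTime_le_pathTime hw p).trans ?_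
  rw [pathTime_eq_sum, pathTime_eq_sum]
  exact List.sum_le_sum fun e _ => h e

/-- A path that leaves the origin uses one of the edges there. -/
lemma add_latticeTime_zeroStar_le (hw : ∀ e, 0 ≤ w e) {b : ℝ}
    (hb : ∀ e : Edge d, (0 : Fin d → ℤ) ∈ e.1 → b ≤ w e) {v : Fin d → ℤ} (hv : v ≠ 0) :
    b + latticeTime (zeroStar w) 0 v ≤ latticeTime w 0 v := by
  refine le_ciInf fun p => ?_
  refine (add_le_add_right (latticeTime_le_pathTime (zeroStar_nonneg hw) p) b).trans ?_
  cases p with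
  | nil => exact absurd rfl hv
  | cons h p =>
    have h0 : zeroStar w ⟨s(0, _), h⟩ = 0 := by simp [zeroStar]
    simp only [pathTime, h0, zero_add]
    refine add_le_add (hb _ (by simp)) ?_
    rw [pathTime_eq_sum, pathTime_eq_sum]
    exact List.sum_le_sum fun e _ => zeroStar_le hw e

/-- Cutting a path at its last visit to the origin shows that the edges at the origin matter only
once. -/
lemma latticeTime_le_zeroStar_add (hw : ∀ e, 0 ≤ w e) {b : ℝ} (hb0 : 0 ≤ b)
    (hb : ∀ e : Edge d, (0 : Fin d → ℤ) ∈ e.1 → w e ≤ b) (v : Fin d → ℤ) :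
    latticeTime w 0 v ≤ latticeTime (zeroStar w) 0 v + b := by
  rw [← sub_le_iff_le_add]
  refine le_ciInf fun p => ?_
  -- The second alternative covers the paths that use an edge at the origin.
  have key : ∀ {u z : Fin d → ℤ} (p : (latticeGraph d).Walk u z),
      latticeTime w u z ≤ pathTime (zeroStar w) p ∨
        latticeTime w 0 z - b ≤ pathTime (zeroStar w) p := by
    intro u z p
    induction p with
    | nil => left; simp [pathTime, latticeTime_self hw]
    | @cons u v z h p ih =>
      have hz := zeroStar_nonneg hw ⟨s(u, v), h⟩
      simp only [pathTime]
      rcases ih with ih | ih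
      · by_cases h0 : (0 : Fin d → ℤ) ∈ s(u, v)
        · right
          rcases Sym2.mem_iff.1 h0 with rfl | rfl
          · have h1 := latticeTime_triangle hw 0 v z
            have h2 := (latticeTime_le_edge hw h).trans (hb _ h0)
            linarith
          · linarith
        · left
          have h1 := latticeTime_triangle hw u v z
          have h2 := latticeTime_le_edge hw h
          have h3 : zeroStar w ⟨s(u, v), h⟩ = w ⟨s(u, v), h⟩ := if_neg h0
          linarith
      · right; linarith
  rcases key p with h | h <;> linarith

end deterministic

/-! ### Moments of variables with Weibull tails -/

section moments

variable {Ω : Type*} [MeasurableSpace Ω] {P : Measure Ω}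

lemma rpow_le_exp {y p c : ℝ} (hy : 0 ≤ y) (hp : 0 < p) (hc : 0 < c) :
    y ^ p ≤ (p / c) ^ p * Real.exp (c * y) := by
  have h1 : y = (p / c) * (c * y / p) := by field_simp
  have h2 : c * y / p ≤ Real.exp (c * y / p) := by
    linarith [Real.add_one_le_exp (c * y / p)]
  have h3 : (c * y / p) ^ p ≤ Real.exp (c * y) := by
    refine (Real.rpow_le_rpow (by positivity) h2 hp.le).trans_eq ?_
    rw [← Real.exp_mul]
    congr 1
    field_simp
  calc y ^ p = (p / c) ^ p * (c * y / p) ^ p := by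
        rw [← Real.mul_rpow (by positivity) (by positivity), ← h1]
    _ ≤ _ := by gcongr

/-- A power of `y ≥ 0` is bounded by the stretched exponential `exp (c y ^ r)`. -/
lemma pow_le_exp_rpow {r c : ℝ} (hr : 0 < r) (hc : 0 < c) (p : ℕ) (hp : 0 < p) :
    ∃ C : ℝ, 0 < C ∧ ∀ y : ℝ, 0 ≤ y → y ^ p ≤ C * Real.exp (c * y ^ r) := by
  have hp' : (0 : ℝ) < p := by exact_mod_cast hp
  refine ⟨(p / r / c) ^ (p / r), by positivity, fun y hy => ?_⟩
  have := rpow_le_exp (p := p / r) (Real.rpow_nonneg hy r) (by positivity) hc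
  rw [← Real.rpow_mul hy, mul_div_cancel₀ _ hr.ne', Real.rpow_natCast] at this
  exact this

/-- Weibull tails of rate `α` give finite stretched exponential moments of every order `c < α`: the
values of `X ^ r` are compared with integers. -/
lemma lintegral_exp_ne_top [IsProbabilityMeasure P] {X : Ω → ℝ} (hX : Measurable X)
    (hX0 : ∀ ω, 0 ≤ X ω) {α β r c : ℝ} (hβ : 0 < β) (hr : 0 < r) (hc : 0 < c) (hcα : c < α)
    (htail : ∀ t : ℝ, 0 ≤ t → P.real {ω | t < X ω} ≤ β * Real.exp (-α * t ^ r)) :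
    ∫⁻ ω, ENNReal.ofReal (Real.exp (c * X ω ^ r)) ∂P ≠ ⊤ := by
  have hmeas : ∀ k : ℕ, MeasurableSet {ω | (k : ℝ) < X ω ^ r} := fun k =>
    measurableSet_lt measurable_const (hX.pow_const r)
  have hbound : ∀ ω, ENNReal.ofReal (Real.exp (c * X ω ^ r)) ≤
      1 + ∑' k : ℕ, ({ω | (k : ℝ) < X ω ^ r}).indicator
        (fun _ => ENNReal.ofReal (Real.exp (c * (k + 1)))) ω := by
    intro ω
    rcases (Real.rpow_nonneg (hX0 ω) r).eq_or_lt with h | h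
    · rw [← h]; simp
    · obtain ⟨k, hk⟩ : ∃ k : ℕ, ⌈X ω ^ r⌉₊ = k + 1 :=
        Nat.exists_eq_succ_of_ne_zero (Nat.ceil_pos.2 h).ne'
      have hk1 : (k : ℝ) < X ω ^ r := Nat.lt_ceil.1 (by omega)
      have hk2 : X ω ^ r ≤ k + 1 := by
        have := Nat.le_ceil (X ω ^ r); rw [hk] at this; exact_mod_cast this
      refine le_trans ?_ (le_add_of_nonneg_left zero_le_one)
      refine le_trans ?_ (ENNReal.le_tsum k)
      rw [Set.indicator_of_mem (show ω ∈ {ω | (k : ℝ) < X ω ^ r} from hk1)]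
      gcongr
  refine ne_top_of_le_ne_top ?_ (lintegral_mono hbound)
  rw [lintegral_add_left measurable_const, lintegral_tsum fun k =>
    (measurable_const.indicator (hmeas k)).aemeasurable]
  refine ENNReal.add_ne_top.2 ⟨by simp, ?_⟩
  have hterm : ∀ k : ℕ, ∫⁻ ω, ({ω | (k : ℝ) < X ω ^ r}).indicator
      (fun _ => ENNReal.ofReal (Real.exp (c * (k + 1)))) ω ∂P ≤
      ENNReal.ofReal (Real.exp c * β * Real.exp (-(α - c)) ^ k) := by
    intro k
    rw [lintegral_indicator_const (hmeas k)]
    have hset : {ω | (k : ℝ) < X ω ^ r} = {ω | (k : ℝ) ^ r⁻¹ < X ω} := by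
      ext ω
      change (k : ℝ) < X ω ^ r ↔ (k : ℝ) ^ r⁻¹ < X ω
      rw [Real.rpow_inv_lt_iff_of_pos (by positivity) (hX0 ω) hr]
    have ht := htail ((k : ℝ) ^ r⁻¹) (by positivity)
    rw [← Real.rpow_mul (by positivity), inv_mul_cancel₀ hr.ne', Real.rpow_one, ← hset] at ht
    rw [← ofReal_measureReal, ← ENNReal.ofReal_mul (by positivity)]
    apply ENNReal.ofReal_le_ofReal
    calc _ ≤ Real.exp (c * (k + 1)) * (β * Real.exp (-α * k)) := by gcongr
      _ = Real.exp c * β * Real.exp (-(α - c)) ^ k := by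
        rw [← Real.exp_nat_mul, mul_left_comm, ← Real.exp_add, mul_assoc, mul_left_comm,
          ← Real.exp_add]
        ring_nf
  refine ne_top_of_le_ne_top ?_ (ENNReal.tsum_le_tsum hterm)
  rw [← ENNReal.ofReal_tsum_of_nonneg (fun k => by positivity)]
  · exact ENNReal.ofReal_ne_top
  · exact (summable_geometric_of_lt_one (Real.exp_pos _).le
      (Real.exp_lt_one_iff.2 (by linarith))).mul_left _

lemma integrable_of_lintegral_exp_ne_top {X : Ω → ℝ} (hX : Measurable X)
    {r c : ℝ} (h : ∫⁻ ω, ENNReal.ofReal (Real.exp (c * X ω ^ r)) ∂P ≠ ⊤) :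
    Integrable (fun ω => Real.exp (c * X ω ^ r)) P :=
  ⟨(Real.measurable_exp.comp ((hX.pow_const r).const_mul c)).aestronglyMeasurable, by
    rw [hasFiniteIntegral_iff_ofReal (ae_of_all _ fun ω => (Real.exp_pos _).le)]
    exact h.lt_top⟩

end moments

/-! ### Measurability and independence for functions of the edge weights -/

section independence

variable {Ω ι : Type*}

/-- The σ-algebra generated by the variables `τ e` with `e ∈ S`. -/
@[reducible] def sigmaOn (τ : ι → Ω → ℝ) (S : Set ι) : MeasurableSpace Ω :=
  ⨆ e ∈ S, MeasurableSpace.comap (τ e) inferInstance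

lemma measurable_sigmaOn {τ : ι → Ω → ℝ} {S : Set ι} {e : ι} (he : e ∈ S) :
    Measurable[sigmaOn τ S] (τ e) :=
  (comap_measurable (τ e)).mono (le_iSup₂_of_le e he le_rfl) le_rfl

lemma sigmaOn_mono {τ : ι → Ω → ℝ} {S S' : Set ι} (h : S ⊆ S') : sigmaOn τ S ≤ sigmaOn τ S' :=
  biSup_mono h

variable [MeasurableSpace Ω] {P : Measure Ω} {τ : ι → Ω → ℝ}

lemma sigmaOn_le (hmeas : ∀ e, Measurable (τ e)) (S : Set ι) :
    sigmaOn τ S ≤ (inferInstance : MeasurableSpace Ω) :=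
  iSup₂_le fun e _ => (hmeas e).comap_le

lemma indep_sigmaOn (hmeas : ∀ e, Measurable (τ e)) (hindep : iIndepFun τ P) {S S' : Set ι}
    (h : Disjoint S S') : Indep (sigmaOn τ S) (sigmaOn τ S') P :=
  indep_iSup_of_disjoint (fun e => (hmeas e).comap_le) hindep h

/-- The expectation of a product factorizes when the factors depend on pairwise disjoint sets of
weights. -/
lemma lintegral_prod_of_disjoint [IsProbabilityMeasure P] (hmeas : ∀ e, Measurable (τ e))
    (hindep : iIndepFun τ P) {κ : Type*} (s : Finset κ) (S : κ → Set ι)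
    (hS : ∀ i ∈ s, ∀ j ∈ s, i ≠ j → Disjoint (S i) (S j)) (G : κ → Ω → ENNReal)
    (hG : ∀ i ∈ s, Measurable[sigmaOn τ (S i)] (G i)) :
    ∫⁻ ω, ∏ i ∈ s, G i ω ∂P = ∏ i ∈ s, ∫⁻ ω, G i ω ∂P := by
  classical
  induction s using Finset.induction_on with
  | empty => simp
  | insert i s hi ih =>
    simp only [Finset.prod_insert hi]
    rw [← ih (fun a ha b hb => hS a (Finset.mem_insert_of_mem ha) b (Finset.mem_insert_of_mem hb))
      (fun a ha => hG a (Finset.mem_insert_of_mem ha))]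
    refine lintegral_mul_eq_lintegral_mul_lintegral_of_independent_measurableSpace
      (sigmaOn_le hmeas (S i)) (sigmaOn_le hmeas (⋃ j ∈ s, S j))
      (indep_sigmaOn hmeas hindep ?_) (hG i (Finset.mem_insert_self _ _)) ?_
    · rw [Set.disjoint_iUnion₂_right]
      exact fun j hj => hS i (Finset.mem_insert_self _ _) j (Finset.mem_insert_of_mem hj)
        (by rintro rfl; exact hi hj)
    · refine Finset.measurable_fun_prod _ fun j hj => ?_
      exact (hG j (Finset.mem_insert_of_mem hj)).mono
        (sigmaOn_mono (Set.subset_biUnion_of_mem (u := S) hj)) le_rfl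

/-- Relabelling the weights by an injective map does not change their joint law. -/
lemma map_comp_injective [IsProbabilityMeasure P] (hmeas : ∀ e, Measurable (τ e))
    (hindep : iIndepFun τ P) (hident : ∀ e e', IdentDistrib (τ e) (τ e') P P) {σ : ι → ι}
    (hσ : Function.Injective σ) :
    P.map (fun ω e => τ (σ e) ω) = P.map (fun ω e => τ e ω) := by
  rw [(hindep.precomp hσ).map_fun_eq_infinitePi_map (fun e => hmeas (σ e)),
    hindep.map_fun_eq_infinitePi_map hmeas]
  congr 1
  ext1 e
  exact (hident (σ e) e).map_eq

lemma integral_comp_injective [IsProbabilityMeasure P] (hmeas : ∀ e, Measurable (τ e))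
    (hindep : iIndepFun τ P) (hident : ∀ e e', IdentDistrib (τ e) (τ e') P P) {σ : ι → ι}
    (hσ : Function.Injective σ) {G : (ι → ℝ) → ℝ} (hG : Measurable G) :
    ∫ ω, G (fun e => τ (σ e) ω) ∂P = ∫ ω, G (fun e => τ e ω) ∂P := by
  have h1 : Measurable fun ω e => τ (σ e) ω := measurable_pi_iff.2 fun e => hmeas (σ e)
  have h2 : Measurable fun ω e => τ e ω := measurable_pi_iff.2 hmeas
  rw [← integral_map h1.aemeasurable hG.aestronglyMeasurable,
    ← integral_map h2.aemeasurable hG.aestronglyMeasurable,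
    map_comp_injective hmeas hindep hident hσ]

end independence

section measurability

variable {d : ℕ} {Ω : Type*} {m : MeasurableSpace Ω} {τ : Edge d → Ω → ℝ}

lemma measurable_pathTime {u v : Fin d → ℤ} (p : (latticeGraph d).Walk u v)
    (h : ∀ e ∈ edgeList p, Measurable (τ e)) :
    Measurable fun ω => pathTime (fun e => τ e ω) p := by
  simp only [pathTime_eq_sum]
  generalize edgeList p = l at h
  induction l with
  | nil => simp
  | cons e l ih =>
    simp only [List.map_cons, List.sum_cons]
    exact (h e (by simp)).add (ih fun e' he' => h e' (by simp [he']))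

lemma measurable_latticeTime (h : ∀ e, Measurable (τ e)) (u v : Fin d → ℤ) :
    Measurable fun ω => latticeTime (fun e => τ e ω) u v :=
  Measurable.iInf fun p => measurable_pathTime p fun e _ => h e

lemma measurable_latticeTime_weights (u v : Fin d → ℤ) :
    Measurable fun w : Edge d → ℝ => latticeTime w u v :=
  measurable_latticeTime (τ := fun e (w : Edge d → ℝ) => w e) (fun e => measurable_pi_apply e) u v

end measurability

/-! ### The time constant -/

section subadditive

/-- Fekete's lemma for functions of a real variable that are subadditive up to a constant. -/
lemma exists_tendsto_of_almost_subadditive {g : ℝ → ℝ} {A B C : ℝ} (hB : 0 ≤ B)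
    (h0 : ∀ t, 0 ≤ g t)
    (hsub : ∀ s t, 0 ≤ s → 0 ≤ t → g (s + t) ≤ g s + g t + C)
    (hlin : ∀ t, 0 ≤ t → g t ≤ A + B * t) :
    ∃ l, Tendsto (fun t : ℝ => t⁻¹ * g t) atTop (𝓝 l) := by
  have hu : Subadditive fun n : ℕ => g n + C := fun m n => by
    have := hsub m n (by positivity) (by positivity)
    push_cast; linarith
  have hC : 0 ≤ A + C := by
    have := hsub 0 0 le_rfl le_rfl
    have := hlin 0 le_rfl
    rw [add_zero] at *
    linarith
  have hlim := hu.tendsto_lim ⟨min 0 C, by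
    rintro _ ⟨n, rfl⟩
    rcases Nat.eq_zero_or_pos n with rfl | hn
    · simp
    · have hn : (1 : ℝ) ≤ n := by exact_mod_cast hn
      have := h0 n
      simp only
      rw [le_div_iff₀ (by positivity)]
      rcases le_total 0 C with h | h
      · rw [min_eq_left h]; nlinarith
      · rw [min_eq_right h]; nlinarith⟩
  set l := hu.lim
  refine ⟨l, ?_⟩
  have hK : Tendsto (fun t : ℝ => t⁻¹ * (A + B + C)) atTop (𝓝 0) := by
    simpa using tendsto_inv_atTop_zero.mul_const (A + B + C)
  have hC0 : Tendsto (fun t : ℝ => t⁻¹ * C) atTop (𝓝 0) := by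
    simpa using tendsto_inv_atTop_zero.mul_const C
  have hfl : Tendsto (fun t : ℝ => (⌊t⌋₊ : ℝ) / t) atTop (𝓝 1) := tendsto_nat_floor_div_atTop
  have hce : Tendsto (fun t : ℝ => (⌈t⌉₊ : ℝ) / t) atTop (𝓝 1) := tendsto_nat_ceil_div_atTop
  -- The limit along the integers bounds `g t` from above via `⌊t⌋` and from below via `⌈t⌉`.
  have h1 := ((hfl.mul (hlim.comp tendsto_nat_floor_atTop)).add hK).sub hC0
  have h2 := ((hce.mul (hlim.comp tendsto_nat_ceil_atTop)).sub hK).sub hC0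
  simp only [one_mul, add_zero, sub_zero] at h1 h2
  refine tendsto_of_tendsto_of_tendsto_of_le_of_le' h2 h1 ?_ ?_
  · filter_upwards [eventually_gt_atTop 0] with t ht
    have hc : 0 < (⌈t⌉₊ : ℝ) := by exact_mod_cast Nat.ceil_pos.2 ht
    have hle := Nat.le_ceil t
    have hlt := Nat.ceil_lt_add_one ht.le
    have h := hsub t (⌈t⌉₊ - t) ht.le (by linarith)
    have h' := hlin (⌈t⌉₊ - t) (by linarith)
    rw [add_sub_cancel] at h
    have hb : B * (⌈t⌉₊ - t) ≤ B * 1 := by gcongr; linarith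
    simp only [Function.comp_apply]
    rw [div_mul_div_comm, mul_comm t, ← div_mul_div_comm, div_self hc.ne', one_mul, div_eq_inv_mul,
      ← mul_sub, ← mul_sub]
    gcongr
    linarith
  · filter_upwards [eventually_ge_atTop 1] with t ht
    have ht0 : 0 < t := by linarith
    have hc : 0 < (⌊t⌋₊ : ℝ) := by exact_mod_cast Nat.floor_pos.2 ht
    have hle := Nat.floor_le ht0.le
    have hlt := Nat.lt_floor_add_one t
    have h := hsub ⌊t⌋₊ (t - ⌊t⌋₊) hc.le (by linarith)
    have h' := hlin (t - ⌊t⌋₊) (by linarith)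
    rw [add_sub_cancel] at h
    have hb : B * (t - ⌊t⌋₊) ≤ B * 1 := by gcongr; linarith
    simp only [Function.comp_apply]
    rw [div_mul_div_comm, mul_comm t, ← div_mul_div_comm, div_self hc.ne', one_mul, div_eq_inv_mul,
      ← mul_add, ← mul_sub]
    gcongr
    linarith

end subadditive

section mean

variable {d : ℕ} {Ω : Type*} [MeasurableSpace Ω] {P : Measure Ω} {τ : Edge d → Ω → ℝ}

lemma pathTime_sq_le (w : Edge d → ℝ) {u v : Fin d → ℤ} (p : (latticeGraph d).Walk u v) :
    pathTime w p ^ 2 ≤ p.length * ((edgeList p).map fun e => w e ^ 2).sum := by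
  rw [pathTime_eq_sum, ← length_edgeList]
  generalize edgeList p = l
  have h := sq_sum_le_card_mul_sum_sq (s := Finset.univ) (f := fun i : Fin l.length => w l[i])
  simp only [Finset.card_univ, Fintype.card_fin] at h
  rw [← Fin.sum_univ_fun_getElem l w, ← Fin.sum_univ_fun_getElem l fun e => w e ^ 2]
  exact h

lemma integral_list_sum_le {ι : Type*} {f : ι → Ω → ℝ} {M : ℝ} (hf : ∀ e, Integrable (f e) P)
    (hM : ∀ e, ∫ ω, f e ω ∂P ≤ M) (l : List ι) :
    Integrable (fun ω => (l.map fun e => f e ω).sum) P ∧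
      ∫ ω, (l.map fun e => f e ω).sum ∂P ≤ l.length * M := by
  induction l with
  | nil => simp
  | cons e l ih =>
    simp only [List.map_cons, List.sum_cons, List.length_cons]
    refine ⟨(hf e).add ih.1, ?_⟩
    rw [integral_add (hf e) ih.1]
    have := hM e
    push_cast
    linarith [ih.2]

/-- The distance `|u - v|₁` on the lattice. -/
def dist₁ (u v : Fin d → ℤ) : ℝ := ∑ i, |((u i : ℤ) : ℝ) - v i|

lemma dist₁_nonneg (u v : Fin d → ℤ) : 0 ≤ dist₁ u v := Finset.sum_nonneg fun _ _ => abs_nonneg _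

lemma exists_walk_length_dist₁ (u v : Fin d → ℤ) :
    ∃ p : (latticeGraph d).Walk u v, (p.length : ℝ) = dist₁ u v := by
  have h := (Int.toNat_of_nonneg (Finset.sum_nonneg fun (i : Fin d) (_ : i ∈ Finset.univ) =>
    abs_nonneg (u i - v i))).symm
  obtain ⟨p, hp⟩ := exists_walk_length _ u v h
  refine ⟨p, ?_⟩
  rw [hp, dist₁]
  exact_mod_cast (congrArg (Int.cast : ℤ → ℝ) h).symm

lemma sq_latticeTime_bound (hmeas : ∀ e, Measurable (τ e)) (hnonneg : ∀ e ω, 0 ≤ τ e ω) {M : ℝ}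
    (hI : ∀ e, Integrable (fun ω => τ e ω ^ 2) P) (hM : ∀ e, ∫ ω, τ e ω ^ 2 ∂P ≤ M)
    (u v : Fin d → ℤ) :
    Integrable (fun ω => latticeTime (fun e => τ e ω) u v ^ 2) P ∧
      ∫ ω, latticeTime (fun e => τ e ω) u v ^ 2 ∂P ≤ dist₁ u v ^ 2 * M := by
  obtain ⟨p, hp⟩ := exists_walk_length_dist₁ u v
  obtain ⟨h1, h2⟩ := integral_list_sum_le hI hM (edgeList p)
  have hle : ∀ ω, latticeTime (fun e => τ e ω) u v ^ 2 ≤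
      p.length * ((edgeList p).map fun e => τ e ω ^ 2).sum := fun ω =>
    (pow_le_pow_left₀ (latticeTime_nonneg (fun e => hnonneg e ω) u v)
      (latticeTime_le_pathTime (fun e => hnonneg e ω) p) 2).trans (pathTime_sq_le _ p)
  have hint : Integrable (fun ω => latticeTime (fun e => τ e ω) u v ^ 2) P :=
    (h1.const_mul p.length).mono'
      ((measurable_latticeTime hmeas u v).pow_const 2).aestronglyMeasurable
      (ae_of_all _ fun ω => by
        rw [Real.norm_of_nonneg (sq_nonneg _)]; exact hle ω)
  refine ⟨hint, (integral_mono hint (h1.const_mul _) hle).trans ?_⟩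
  rw [integral_const_mul, sq, mul_assoc, ← hp]
  rw [length_edgeList] at h2
  gcongr

lemma latticeTime_bound (hmeas : ∀ e, Measurable (τ e)) (hnonneg : ∀ e ω, 0 ≤ τ e ω) {M : ℝ}
    (hI : ∀ e, Integrable (τ e) P) (hM : ∀ e, ∫ ω, τ e ω ∂P ≤ M) (u v : Fin d → ℤ) :
    Integrable (fun ω => latticeTime (fun e => τ e ω) u v) P ∧
      ∫ ω, latticeTime (fun e => τ e ω) u v ∂P ≤ dist₁ u v * M := by
  obtain ⟨p, hp⟩ := exists_walk_length_dist₁ u v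
  obtain ⟨h1, h2⟩ := integral_list_sum_le hI hM (edgeList p)
  have hle : ∀ ω, latticeTime (fun e => τ e ω) u v ≤ ((edgeList p).map fun e => τ e ω).sum :=
    fun ω => by
      rw [← pathTime_eq_sum (fun e => τ e ω)]
      exact latticeTime_le_pathTime (fun e => hnonneg e ω) p
  have hint : Integrable (fun ω => latticeTime (fun e => τ e ω) u v) P :=
    h1.mono' (measurable_latticeTime hmeas u v).aestronglyMeasurable
      (ae_of_all _ fun ω => by
        rw [Real.norm_of_nonneg (latticeTime_nonneg (fun e => hnonneg e ω) u v)]; exact hle ω)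
  refine ⟨hint, (integral_mono hint h1 hle).trans ?_⟩
  rwa [← hp, ← length_edgeList]

/-- The mean passage time from the origin to a lattice point. -/
noncomputable def meanTime (P : Measure Ω) (τ : Edge d → Ω → ℝ) (v : Fin d → ℤ) : ℝ :=
  ∫ ω, latticeTime (fun e => τ e ω) 0 v ∂P

lemma meanPassageTime_eq (y : Fin d → ℝ) :
    meanPassageTime P τ y = meanTime P τ (latticeFloor y) := by
  simp only [meanPassageTime, meanTime, passageTime_eq, latticeFloor_zero]

lemma meanTime_nonneg (hnonneg : ∀ e ω, 0 ≤ τ e ω) (v : Fin d → ℤ) : 0 ≤ meanTime P τ v :=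
  integral_nonneg fun ω => latticeTime_nonneg (fun e => hnonneg e ω) 0 v

lemma sum_abs_latticeFloor_le (y : Fin d → ℝ) :
    ∑ i, |((latticeFloor y i : ℤ) : ℝ)| ≤ (∑ i, |y i|) + d := by
  calc ∑ i, |((latticeFloor y i : ℤ) : ℝ)| ≤ ∑ i, (|y i| + 1) := by
        refine Finset.sum_le_sum fun i _ => ?_
        simp only [latticeFloor]
        have h1 := Int.floor_le (y i)
        have h2 := Int.lt_floor_add_one (y i)
        rw [abs_le]
        constructor
        · linarith [neg_abs_le (y i)]
        · linarith [le_abs_self (y i)]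
    _ = _ := by simp [Finset.sum_add_distrib]

/-- Independent identically distributed non-negative edge weights whose first two moments are
bounded by `M`. -/
structure IIDWeights (P : Measure Ω) (τ : Edge d → Ω → ℝ) (M : ℝ) : Prop where
  meas : ∀ e, Measurable (τ e)
  nonneg : ∀ e ω, 0 ≤ τ e ω
  indep : iIndepFun τ P
  ident : ∀ e e', IdentDistrib (τ e) (τ e') P P
  M_nonneg : 0 ≤ M
  integrable : ∀ e, Integrable (τ e) P
  integral_le : ∀ e, ∫ ω, τ e ω ∂P ≤ M
  integrable_sq : ∀ e, Integrable (fun ω => τ e ω ^ 2) P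
  integral_sq_le : ∀ e, ∫ ω, τ e ω ^ 2 ∂P ≤ M

namespace IIDWeights

variable {M : ℝ}

lemma integrable_latticeTime (H : IIDWeights P τ M) (u v : Fin d → ℤ) :
    Integrable (fun ω => latticeTime (fun e => τ e ω) u v) P :=
  (latticeTime_bound H.meas H.nonneg H.integrable H.integral_le u v).1

lemma integral_latticeTime [IsProbabilityMeasure P] (H : IIDWeights P τ M) (u v : Fin d → ℤ) :
    ∫ ω, latticeTime (fun e => τ e ω) u v ∂P = meanTime P τ (v - u) := by
  have h := integral_comp_injective H.meas H.indep H.ident (shiftEdge_injective u)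
    (measurable_latticeTime_weights 0 (v - u))
  rw [meanTime, ← h]
  refine integral_congr_ae (ae_of_all _ fun ω => ?_)
  have := latticeTime_shift (fun e => H.nonneg e ω) u 0 (v - u)
  simpa using this.symm

lemma meanTime_add_le [IsProbabilityMeasure P] (H : IIDWeights P τ M) (u v : Fin d → ℤ) :
    meanTime P τ (u + v) ≤ meanTime P τ u + meanTime P τ v := by
  have h := H.integral_latticeTime u (u + v)
  rw [add_sub_cancel_left] at h
  rw [← h, meanTime, meanTime,
    ← integral_add (H.integrable_latticeTime _ _) (H.integrable_latticeTime _ _)]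
  exact integral_mono (H.integrable_latticeTime _ _)
    ((H.integrable_latticeTime _ _).add (H.integrable_latticeTime _ _)) fun ω =>
    latticeTime_triangle (fun e => H.nonneg e ω) 0 u (u + v)

lemma meanTime_le (H : IIDWeights P τ M) (v : Fin d → ℤ) :
    meanTime P τ v ≤ (∑ i, |(v i : ℝ)|) * M := by
  have := (latticeTime_bound H.meas H.nonneg H.integrable H.integral_le 0 v).2
  simpa [dist₁, meanTime] using this

/-- The displacement `⌊(t + s) x⌋ - ⌊t x⌋` has nearly the mean passage time of `⌊s x⌋`, since their
coordinates differ by at most one. -/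
lemma meanTime_increment_le [IsProbabilityMeasure P] (H : IIDWeights P τ M) (x : Fin d → ℝ)
    (t s : ℝ) :
    meanTime P τ (latticeFloor ((t + s) • x) - latticeFloor (t • x)) ≤
      meanTime P τ (latticeFloor (s • x)) + d * M := by
  set v := latticeFloor (s • x)
  set v' := latticeFloor ((t + s) • x) - latticeFloor (t • x)
  have h := H.meanTime_add_le v (v' - v)
  rw [add_sub_cancel] at h
  refine h.trans (add_le_add_right ((H.meanTime_le _).trans ?_) _)
  refine mul_le_mul_of_nonneg_right ?_ H.M_nonneg
  calc ∑ i, |(((v' - v) i : ℤ) : ℝ)| ≤ ∑ i : Fin d, (1 : ℝ) := by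
        refine Finset.sum_le_sum fun i _ => ?_
        have h1 : |(v' - v) i| ≤ 1 := by
          simp only [v, v', latticeFloor, Pi.sub_apply, Pi.smul_apply, smul_eq_mul, add_mul]
          have := Int.le_floor_add (t * x i) (s * x i)
          have := Int.le_floor_add_floor (t * x i) (s * x i)
          rw [abs_le]
          constructor <;> omega
        exact_mod_cast h1
    _ = d := by simp

lemma exists_tendsto_meanPassageTime [IsProbabilityMeasure P] (H : IIDWeights P τ M)
    (x : Fin d → ℝ) :
    ∃ l, Tendsto (fun t : ℝ => t⁻¹ * meanPassageTime P τ (t • x)) atTop (𝓝 l) := by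
  simp only [meanPassageTime_eq]
  refine exists_tendsto_of_almost_subadditive (A := d * M) (B := (∑ i, |x i|) * M) (C := d * M)
    (mul_nonneg (Finset.sum_nonneg fun i _ => abs_nonneg _) H.M_nonneg)
    (fun t => meanTime_nonneg H.nonneg _) (fun s t hs ht => ?_) (fun t ht => ?_)
  · have h1 := H.meanTime_increment_le x s t
    have h2 := H.meanTime_add_le (latticeFloor (s • x))
      (latticeFloor ((s + t) • x) - latticeFloor (s • x))
    rw [add_sub_cancel] at h2
    linarith
  · refine (H.meanTime_le _).trans ?_
    have h := sum_abs_latticeFloor_le (t • x)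
    simp only [Pi.smul_apply, smul_eq_mul, abs_mul, abs_of_nonneg ht, ← Finset.mul_sum] at h
    calc _ ≤ (t * ∑ i, |x i| + d) * M := by gcongr; exact H.M_nonneg
      _ = _ := by ring

lemma tendsto_meanPassageTime [IsProbabilityMeasure P] (H : IIDWeights P τ M) (x : Fin d → ℝ) :
    Tendsto (fun t : ℝ => t⁻¹ * meanPassageTime P τ (t • x)) atTop (𝓝 (timeConstant P τ x)) :=
  tendsto_nhds_limUnder (H.exists_tendsto_meanPassageTime x)

lemma timeConstant_nonneg [IsProbabilityMeasure P] (H : IIDWeights P τ M) (x : Fin d → ℝ) :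
    0 ≤ timeConstant P τ x := by
  refine ge_of_tendsto (H.tendsto_meanPassageTime x) ?_
  filter_upwards [eventually_ge_atTop 0] with t ht
  rw [meanPassageTime_eq]
  exact mul_nonneg (inv_nonneg.2 ht) (meanTime_nonneg H.nonneg _)

end IIDWeights

end mean

/-! ### The lower bound: all edges at the origin are slow -/

section star

variable {d : ℕ}

/-- The `2d` unit vectors `±e_j` of the lattice. -/
def dir (i : Fin d × Bool) : Fin d → ℤ := Pi.single i.1 (if i.2 then 1 else -1)

lemma adj_add_dir (u : Fin d → ℤ) (i : Fin d × Bool) : (latticeGraph d).Adj u (u + dir i) := by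
  rw [adj_iff, Finset.sum_eq_single i.1]
  · rcases i with ⟨j, _ | _⟩ <;> simp [dir]
  · intro j _ hj; simp [dir, hj]
  · simp

lemma dir_injective : Function.Injective (dir (d := d)) := by
  rintro ⟨j, b⟩ ⟨j', b'⟩ h
  have h1 := congrFun h j
  have h2 : j = j' := by
    by_contra hne
    simp only [dir, Pi.single_eq_same, Pi.single_eq_of_ne hne] at h1
    split_ifs at h1; all_goals omega
  subst h2
  simp only [dir, Pi.single_eq_same] at h1
  cases b <;> cases b' <;> simp_all

lemma exists_dir_of_adj {v : Fin d → ℤ} (h : (latticeGraph d).Adj 0 v) : ∃ i, v = dir i := by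
  rw [adj_iff] at h
  simp only [Pi.zero_apply, zero_sub, abs_neg] at h
  obtain ⟨j, hj⟩ : ∃ j, v j ≠ 0 := by
    by_contra! hc
    simp [hc] at h
  rw [← Finset.add_sum_erase _ _ (Finset.mem_univ j)] at h
  have h1 : 0 < |v j| := abs_pos.2 hj
  have h2 : 0 ≤ ∑ i ∈ Finset.univ.erase j, |v i| := Finset.sum_nonneg fun i _ => abs_nonneg _
  have h3 : ∑ i ∈ Finset.univ.erase j, |v i| = 0 := by omega
  have h4 : |v j| = 1 := by omega
  have h5 : ∀ i, i ≠ j → v i = 0 := fun i hi => by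
    have := (Finset.sum_eq_zero_iff_of_nonneg fun i _ => abs_nonneg (v i)).1 h3 i
      (Finset.mem_erase.2 ⟨hi, Finset.mem_univ i⟩)
    simpa using this
  rcases (abs_eq zero_le_one).1 h4 with h6 | h6
  · refine ⟨(j, true), funext fun i => ?_⟩
    by_cases hi : i = j
    · subst hi; simp [dir, h6]
    · simp [dir, h5 i hi, hi]
  · refine ⟨(j, false), funext fun i => ?_⟩
    by_cases hi : i = j
    · subst hi; simp [dir, h6]
    · simp [dir, h5 i hi, hi]

/-- The `2d` edges at the origin. -/
def starEdge (i : Fin d × Bool) : Edge d :=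
  ⟨s(0, dir i), by simpa using adj_add_dir (0 : Fin d → ℤ) i⟩

lemma starEdge_injective : Function.Injective (starEdge (d := d)) := by
  intro i j h
  have h1 : s((0 : Fin d → ℤ), dir i) = s(0, dir j) := congrArg Subtype.val h
  exact dir_injective (Sym2.congr_right.1 h1)

lemma exists_starEdge {e : Edge d} (h : (0 : Fin d → ℤ) ∈ e.1) : ∃ i, e = starEdge i := by
  obtain ⟨e, he⟩ := e
  obtain ⟨v, rfl⟩ := h
  obtain ⟨i, rfl⟩ := exists_dir_of_adj he
  exact ⟨i, rfl⟩

end star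

section secondMoment

variable {Ω : Type*} [MeasurableSpace Ω] {P : Measure Ω} [IsProbabilityMeasure P]

/-- A non-negative variable whose mean exceeds `a ≥ 0` is above `a` with a probability that is
controlled by its second moment. -/
lemma sq_div_le_prob {Z : Ω → ℝ} (hZm : Measurable Z) {a δ S : ℝ}
    (ha : 0 ≤ a) (hδ : 0 < δ) (hS : 0 < S) (hZ : Integrable Z P)
    (hZ2 : Integrable (fun ω => Z ω ^ 2) P) (hmean : a + δ ≤ ∫ ω, Z ω ∂P)
    (hsq : ∫ ω, Z ω ^ 2 ∂P ≤ S) : δ ^ 2 / S ≤ P.real {ω | a < Z ω} := by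
  have hms : MeasurableSet {ω | a < Z ω} := measurableSet_lt measurable_const hZm
  set l := δ / (2 * S)
  have hl : 0 < l := by positivity
  have hle : ∀ ω, Z ω - a ≤ l * Z ω ^ 2 +
      ({ω | a < Z ω}).indicator (fun _ => 1 / (4 * l)) ω := by
    intro ω
    by_cases h : ω ∈ {ω | a < Z ω}
    · rw [Set.indicator_of_mem h]
      have h1 : l * Z ω ^ 2 + 1 / (4 * l) - Z ω = (2 * l * Z ω - 1) ^ 2 / (4 * l) := by
        field_simp; ring
      have h2 : 0 ≤ (2 * l * Z ω - 1) ^ 2 / (4 * l) := by positivity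
      linarith
    · rw [Set.indicator_of_notMem h]
      have h1 : Z ω ≤ a := not_lt.1 h
      have : 0 ≤ l * Z ω ^ 2 := by positivity
      linarith
  have hint : Integrable (({ω | a < Z ω}).indicator fun _ => 1 / (4 * l)) P :=
    (integrable_const _).indicator hms
  have h := integral_mono (hZ.sub (integrable_const a)) ((hZ2.const_mul l).add hint) hle
  simp only [Pi.add_apply, Pi.sub_apply] at h
  rw [integral_add (hZ2.const_mul l) hint, integral_sub hZ (integrable_const a),
    integral_const_mul, integral_indicator_const _ hms] at h
  simp only [integral_const, probReal_univ, smul_eq_mul] at h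
  have h1 : l * ∫ ω, Z ω ^ 2 ∂P ≤ l * S := by gcongr
  have h2 : l * S = δ / 2 := by simp only [l]; field_simp
  have h3 : δ / 2 ≤ P.real {ω | a < Z ω} * (1 / (4 * l)) := by linarith
  have h4 : 1 / (4 * l) = S / (2 * δ) := by simp only [l]; field_simp; ring
  rw [h4] at h3
  rw [div_le_iff₀ hS]
  have h5 : δ / 2 * (2 * δ) ≤ P.real {ω | a < Z ω} * (S / (2 * δ)) * (2 * δ) := by gcongr
  have h6 : P.real {ω | a < Z ω} * (S / (2 * δ)) * (2 * δ) = P.real {ω | a < Z ω} * S := by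
    field_simp
  nlinarith

end secondMoment

section lower

/-- The weights without the star of the origin only depend on the other edges. -/
lemma zeroStar_measurable {d : ℕ} {Ω : Type*} (τ : Edge d → Ω → ℝ) (e : Edge d) :
    Measurable[sigmaOn τ {e | (0 : Fin d → ℤ) ∉ e.1}] fun ω => zeroStar (fun e => τ e ω) e := by
  by_cases h : (0 : Fin d → ℤ) ∈ e.1
  · simp only [zeroStar, if_pos h]; exact measurable_const
  · simp only [zeroStar, if_neg h]; exact measurable_sigmaOn h

variable {d : ℕ} {Ω : Type*} [MeasurableSpace Ω] {P : Measure Ω} [IsProbabilityMeasure P]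
  {τ : Edge d → Ω → ℝ} {M : ℝ}

lemma latticeFloor_ne_zero {x : Fin d → ℝ} (hx : x ≠ 0) :
    ∀ᶠ n : ℕ in atTop, latticeFloor ((n : ℝ) • x) ≠ 0 := by
  obtain ⟨b, hb⟩ := Function.ne_iff.1 hx
  have hb : 0 < |x b| := abs_pos.2 hb
  filter_upwards [(tendsto_natCast_atTop_atTop (R := ℝ)).eventually_ge_atTop (1 / |x b|)]
    with n hn h
  have h1 : 1 ≤ |(n : ℝ) * x b| := by
    rw [abs_mul, abs_of_nonneg (Nat.cast_nonneg n)]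
    rwa [div_le_iff₀ hb] at hn
  have h2 : ⌊(n : ℝ) * x b⌋ = 0 := congrFun h b
  rw [Int.floor_eq_zero_iff] at h2
  rw [abs_of_nonneg h2.1] at h1
  exact absurd h2.2 (not_lt.2 h1)

namespace IIDWeights

/-- After removal of the edges at the origin, the passage time to `⌊n x⌋` is not much below
`n μ(x)` with a probability that is bounded below. -/
lemma prob_zeroStar_ge (H : IIDWeights P τ M) (x : Fin d → ℝ) {ε : ℝ} (hε : 0 < ε) :
    ∃ c : ℝ, 0 < c ∧ ∀ᶠ n : ℕ in atTop, c ≤ P.real {ω | (n : ℝ) * (timeConstant P τ x - ε) <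
      latticeTime (zeroStar fun e => τ e ω) 0 (latticeFloor ((n : ℝ) • x))} := by
  set μ := timeConstant P τ x
  set T' : ℕ → Ω → ℝ := fun n ω =>
    latticeTime (zeroStar fun e => τ e ω) 0 (latticeFloor ((n : ℝ) • x))
  have hT'0 : ∀ n ω, 0 ≤ T' n ω := fun n ω =>
    latticeTime_nonneg (zeroStar_nonneg fun e => H.nonneg e ω) _ _
  -- The second moment method needs a non-negative threshold; if `μ < ε` there is nothing to prove.
  rcases lt_or_ge μ ε with hμ | hμ
  · refine ⟨1, one_pos, ?_⟩
    filter_upwards [eventually_ge_atTop 1] with n hn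
    have hn : (0 : ℝ) < n := by exact_mod_cast hn
    have : {ω | (n : ℝ) * (μ - ε) < T' n ω} = Set.univ := by
      ext ω
      have : (n : ℝ) * (μ - ε) < 0 := mul_neg_of_pos_of_neg hn (by linarith)
      simpa using this.trans_le (hT'0 n ω)
    rw [this, probReal_univ]
  · set K := ((∑ i, |x i|) + d) ^ 2 * M + 1
    have hK : 0 < K := by
      have := H.M_nonneg
      positivity
    refine ⟨(ε / 2) ^ 2 / K, by positivity, ?_⟩
    have hlim := (H.tendsto_meanPassageTime x).comp (tendsto_natCast_atTop_atTop (R := ℝ))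
    have hev := hlim.eventually (lt_mem_nhds (show μ - ε / 4 < μ by linarith))
    filter_upwards [hev, eventually_ge_atTop 1,
      (tendsto_natCast_atTop_atTop (R := ℝ)).eventually_ge_atTop (4 * (2 * d * M) / ε)]
      with n hn hn1 hn2
    have hn0 : (1 : ℝ) ≤ n := by exact_mod_cast hn1
    set v := latticeFloor ((n : ℝ) • x)
    have hm : Measurable (T' n) :=
      measurable_latticeTime
        (fun e => (zeroStar_measurable τ e).mono (sigmaOn_le H.meas _) le_rfl) 0 v
    have hle : ∀ ω, T' n ω ≤ latticeTime (fun e => τ e ω) 0 v := fun ω =>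
      latticeTime_mono (zeroStar_nonneg fun e => H.nonneg e ω)
        (zeroStar_le fun e => H.nonneg e ω) _ _
    have hint : Integrable (T' n) P := (H.integrable_latticeTime 0 v).mono' hm.aestronglyMeasurable
      (ae_of_all _ fun ω => by rw [Real.norm_of_nonneg (hT'0 n ω)]; exact hle ω)
    obtain ⟨hs1, hs2⟩ := sq_latticeTime_bound H.meas H.nonneg H.integrable_sq H.integral_sq_le 0 v
    have hle2 : ∀ ω, T' n ω ^ 2 ≤ latticeTime (fun e => τ e ω) 0 v ^ 2 := fun ω =>
      pow_le_pow_left₀ (hT'0 n ω) (hle ω) 2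
    have hint2 : Integrable (fun ω => T' n ω ^ 2) P := hs1.mono'
      (hm.pow_const 2).aestronglyMeasurable
      (ae_of_all _ fun ω => by rw [Real.norm_of_nonneg (sq_nonneg _)]; exact hle2 ω)
    have hdist : dist₁ 0 v ≤ n * ((∑ i, |x i|) + d) := by
      have h := sum_abs_latticeFloor_le ((n : ℝ) • x)
      simp only [Pi.smul_apply, smul_eq_mul, abs_mul, Nat.abs_cast, ← Finset.mul_sum] at h
      calc dist₁ 0 v = ∑ i, |((v i : ℤ) : ℝ)| := by simp [dist₁]
        _ ≤ n * ∑ i, |x i| + d := h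
        _ ≤ n * ((∑ i, |x i|) + d) := by nlinarith [(Nat.cast_nonneg d : (0 : ℝ) ≤ d)]
    have hsq : ∫ ω, T' n ω ^ 2 ∂P ≤ n ^ 2 * K := by
      refine (integral_mono hint2 hs1 hle2).trans (hs2.trans ?_)
      calc dist₁ 0 v ^ 2 * M ≤ (n * ((∑ i, |x i|) + d)) ^ 2 * M := by
            have := H.M_nonneg
            have := dist₁_nonneg 0 v
            gcongr
        _ ≤ n ^ 2 * K := by simp only [K]; nlinarith
    have hmean : n * (μ - ε) + n * (ε / 2) ≤ ∫ ω, T' n ω ∂P := by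
      have h1 : ∀ ω, latticeTime (fun e => τ e ω) 0 v ≤ T' n ω + ∑ i, τ (starEdge i) ω := fun ω =>
        latticeTime_le_zeroStar_add (fun e => H.nonneg e ω)
          (Finset.sum_nonneg fun i _ => H.nonneg _ ω) (fun e he => by
            obtain ⟨i, rfl⟩ := exists_starEdge he
            exact Finset.single_le_sum (f := fun i => τ (starEdge i) ω) (fun i _ => H.nonneg _ ω)
              (Finset.mem_univ i)) v
      have hsum : Integrable (fun ω => ∑ i, τ (starEdge i) ω) P :=
        integrable_finsetSum _ fun i _ => H.integrable _
      have h2 := integral_mono (H.integrable_latticeTime 0 v) (hint.add hsum) h1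
      simp only [Pi.add_apply] at h2
      rw [integral_add hint hsum, integral_finsetSum _ fun i _ => H.integrable _] at h2
      have h3 : ∑ i : Fin d × Bool, ∫ ω, τ (starEdge i) ω ∂P ≤ 2 * d * M := by
        refine (Finset.sum_le_sum fun i _ => H.integral_le (starEdge i)).trans_eq ?_
        simp [mul_comm]
      simp only [Function.comp_apply, meanPassageTime_eq] at hn
      rw [lt_inv_mul_iff₀ (by linarith)] at hn
      rw [div_le_iff₀ hε] at hn2
      have h4 : n * (μ - ε / 4) < ∫ ω, latticeTime (fun e => τ e ω) 0 v ∂P := hn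
      nlinarith
    have h := sq_div_le_prob hm (mul_nonneg (by linarith) (by linarith : 0 ≤ μ - ε))
      (by positivity) (by positivity) hint hint2 hmean hsq
    refine le_of_eq_of_le ?_ h
    rw [mul_pow, mul_div_mul_left _ _ (by positivity)]

/-- The lower bound of the large deviation estimate: with a probability of order
`exp (-2 d α (n ξ) ^ r)` all edges at the origin are slow, and the rest of the path takes about the
time `n μ(x)`. -/
lemma prob_ge (H : IIDWeights P τ M) {x : Fin d → ℝ} (hx : x ≠ 0) {β α r ξ ρ : ℝ} (hβ : 0 < β)
    (hξ : 0 < ξ)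
    (htail : ∀ e, ∀ t : ℝ, 0 ≤ t → β * Real.exp (-α * t ^ r) ≤ P.real {ω | t < τ e ω})
    (hρ : 2 * d * α * ξ ^ r < ρ) :
    ∃ c : ℝ, 0 < c ∧ ∀ᶠ n : ℕ in atTop, c * Real.exp (-ρ * (n : ℝ) ^ r) ≤
      P.real {ω | (n : ℝ) * (timeConstant P τ x + ξ) <
        latticeTime (fun e => τ e ω) 0 (latticeFloor ((n : ℝ) • x))} := by
  set μ := timeConstant P τ x
  obtain ⟨ε, hε, hερ⟩ : ∃ ε : ℝ, 0 < ε ∧ 2 * d * α * (ξ + 2 * ε) ^ r < ρ := by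
    have hc : Tendsto (fun ε : ℝ => 2 * d * α * (ξ + 2 * ε) ^ r) (𝓝[>] 0)
        (𝓝 (2 * d * α * (ξ + 2 * 0) ^ r)) := by
      refine Tendsto.mono_left ?_ nhdsWithin_le_nhds
      refine ContinuousAt.tendsto (f := fun ε : ℝ => 2 * d * α * (ξ + 2 * ε) ^ r) ?_
      refine ContinuousAt.mul continuousAt_const (ContinuousAt.rpow_const (by fun_prop) ?_)
      left; simpa using hξ.ne'
    rw [mul_zero, add_zero] at hc
    obtain ⟨ε, h1, h2⟩ := ((hc.eventually (gt_mem_nhds hρ)).and self_mem_nhdsWithin).exists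
    exact ⟨ε, h2, h1⟩
  obtain ⟨c, hc, hev⟩ := H.prob_zeroStar_ge x hε
  refine ⟨β ^ (2 * d) * c, by positivity, ?_⟩
  filter_upwards [hev, latticeFloor_ne_zero hx, eventually_ge_atTop 1] with n hn hv hn1
  have hn0 : (1 : ℝ) ≤ n := by exact_mod_cast hn1
  set v := latticeFloor ((n : ℝ) • x)
  set b := (n : ℝ) * (ξ + 2 * ε)
  have hb : 0 ≤ b := by positivity
  -- The edges at the origin are slow on `A`, and the other edges are not atypically fast on `B`.
  set A := ⋂ i : Fin d × Bool, {ω | b < τ (starEdge i) ω}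
  set B := {ω | (n : ℝ) * (μ - ε) < latticeTime (zeroStar fun e => τ e ω) 0 v}
  have hsub : A ∩ B ⊆ {ω | (n : ℝ) * (μ + ξ) < latticeTime (fun e => τ e ω) 0 v} := by
    rintro ω ⟨hA, hB⟩
    have hA' : ∀ i, b < τ (starEdge i) ω := fun i => Set.mem_iInter.1 hA i
    have h := add_latticeTime_zeroStar_le (fun e => H.nonneg e ω) (b := b) (fun e he => by
      obtain ⟨i, rfl⟩ := exists_starEdge he
      exact (hA' i).le) hv
    have hB' : (n : ℝ) * (μ - ε) < latticeTime (zeroStar fun e => τ e ω) 0 v := hB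
    change (n : ℝ) * (μ + ξ) < latticeTime (fun e => τ e ω) 0 v
    simp only [b] at h
    nlinarith
  have hmA : MeasurableSet[sigmaOn τ {e | (0 : Fin d → ℤ) ∈ e.1}] A := by
    refine MeasurableSet.iInter fun i => ?_
    exact measurableSet_lt measurable_const (measurable_sigmaOn (by simp [starEdge]))
  have hmB : MeasurableSet[sigmaOn τ {e | (0 : Fin d → ℤ) ∉ e.1}] B :=
    measurableSet_lt measurable_const (measurable_latticeTime (zeroStar_measurable τ) 0 v)
  have hind : P (A ∩ B) = P A * P B := by
    exact (Indep_iff _ _ _).1 (indep_sigmaOn H.meas H.indep disjoint_compl_right) A B hmA hmB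
  have hPA : P A = ∏ i : Fin d × Bool, P {ω | b < τ (starEdge i) ω} := by
    refine (H.indep.precomp starEdge_injective).meas_iInter fun i => ?_
    exact ⟨Set.Ioi b, measurableSet_Ioi, rfl⟩
  have hPA' : P.real A = ∏ i : Fin d × Bool, P.real {ω | b < τ (starEdge i) ω} := by
    simp only [Measure.real, hPA, ENNReal.toReal_prod]
  have hPA2 : (β * Real.exp (-α * b ^ r)) ^ (2 * d) ≤ P.real A := by
    rw [hPA']
    have : (β * Real.exp (-α * b ^ r)) ^ (2 * d) =
        ∏ i : Fin d × Bool, β * Real.exp (-α * b ^ r) := by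
      simp [mul_comm]
    rw [this]
    exact Finset.prod_le_prod (fun i _ => by positivity) fun i _ => htail _ b hb
  refine le_trans ?_ (measureReal_mono hsub)
  rw [measureReal_def, hind, ENNReal.toReal_mul, ← measureReal_def, ← measureReal_def]
  calc β ^ (2 * d) * c * Real.exp (-ρ * (n : ℝ) ^ r)
      ≤ β ^ (2 * d) * c * Real.exp (-α * b ^ r) ^ (2 * d) := by
        gcongr
        rw [← Real.exp_nat_mul]
        apply Real.exp_le_exp.2
        simp only [b]
        rw [Real.mul_rpow (by positivity) (by positivity)]
        have hp : 0 < (n : ℝ) ^ r := by positivity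
        push_cast
        nlinarith
    _ = (β * Real.exp (-α * b ^ r)) ^ (2 * d) * c := by rw [mul_pow]; ring
    _ ≤ P.real A * P.real B := by gcongr

end IIDWeights

end lower

/-! ### Exponential bounds for sums -/

section chernoff

lemma exp_le_one_add_add_sq_mul {y : ℝ} (hy : 0 ≤ y) :
    Real.exp y ≤ 1 + y + y ^ 2 * Real.exp y := by
  have h1 : Real.exp y * (1 - y) ≤ 1 := by
    have h2 : 1 - y ≤ Real.exp (-y) := by linarith [Real.add_one_le_exp (-y)]
    calc Real.exp y * (1 - y) ≤ Real.exp y * Real.exp (-y) := by gcongr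
      _ = 1 := by rw [← Real.exp_add]; simp
  nlinarith

variable {Ω ι : Type*} [MeasurableSpace Ω] {P : Measure Ω} [IsProbabilityMeasure P]
  {τ : ι → Ω → ℝ}

/-- The exponential Markov inequality for variables that depend on disjoint sets of weights. -/
lemma prob_le_sum_le_exp (hmeas : ∀ e, Measurable (τ e))
    (hindep : iIndepFun τ P) {κ : Type*} (s : Finset κ) (S : κ → Set ι)
    (hS : ∀ i ∈ s, ∀ j ∈ s, i ≠ j → Disjoint (S i) (S j)) (Z : κ → Ω → ℝ)
    (hZ : ∀ i ∈ s, Measurable[sigmaOn τ (S i)] (Z i)) {b t : ℝ}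
    (hb : ∀ i ∈ s, ∫⁻ ω, ENNReal.ofReal (Real.exp (Z i ω)) ∂P ≤ ENNReal.ofReal (Real.exp b)) :
    P.real {ω | t ≤ ∑ i ∈ s, Z i ω} ≤ Real.exp (s.card * b - t) := by
  have hZ' : ∀ i ∈ s, Measurable (Z i) := fun i hi => (hZ i hi).mono (sigmaOn_le hmeas _) le_rfl
  have hm : Measurable fun ω => ENNReal.ofReal (Real.exp (∑ i ∈ s, Z i ω)) :=
    (Real.measurable_exp.comp (Finset.measurable_fun_sum s hZ')).ennreal_ofReal
  have h1 := mul_meas_ge_le_lintegral (μ := P) hm (ENNReal.ofReal (Real.exp t))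
  have h2 : ∫⁻ ω, ENNReal.ofReal (Real.exp (∑ i ∈ s, Z i ω)) ∂P ≤
      ENNReal.ofReal (Real.exp (s.card * b)) := by
    calc ∫⁻ ω, ENNReal.ofReal (Real.exp (∑ i ∈ s, Z i ω)) ∂P
        = ∫⁻ ω, ∏ i ∈ s, ENNReal.ofReal (Real.exp (Z i ω)) ∂P := by
          refine lintegral_congr fun ω => ?_
          rw [Real.exp_sum, ENNReal.ofReal_prod_of_nonneg fun i _ => (Real.exp_pos _).le]
      _ = ∏ i ∈ s, ∫⁻ ω, ENNReal.ofReal (Real.exp (Z i ω)) ∂P := by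
          refine lintegral_prod_of_disjoint hmeas hindep s S hS _ fun i hi => ?_
          exact (Real.measurable_exp.comp (hZ i hi)).ennreal_ofReal
      _ ≤ ∏ i ∈ s, ENNReal.ofReal (Real.exp b) := Finset.prod_le_prod' hb
      _ = _ := by
          rw [Finset.prod_const, ← ENNReal.ofReal_pow (Real.exp_pos _).le, ← Real.exp_nat_mul]
  have h3 : {ω | t ≤ ∑ i ∈ s, Z i ω} ⊆
      {ω | ENNReal.ofReal (Real.exp t) ≤ ENNReal.ofReal (Real.exp (∑ i ∈ s, Z i ω))} :=
    fun ω hω => ENNReal.ofReal_le_ofReal (Real.exp_le_exp.2 hω)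
  have h4 := ((mul_le_mul_right (measure_mono h3) (ENNReal.ofReal (Real.exp t))).trans h1).trans h2
  rw [← ofReal_measureReal, ← ENNReal.ofReal_mul (Real.exp_pos t).le,
    ENNReal.ofReal_le_ofReal_iff (Real.exp_pos _).le] at h4
  rw [Real.exp_sub, le_div_iff₀ (Real.exp_pos t), mul_comm]
  exact h4

/-- A large deviation bound for sums of independent variables with stretched exponential tails,
truncated at the level `B m`. The constant `c` does not depend on the number of variables. -/
lemma exists_prob_truncated_sum_le (hmeas : ∀ e, Measurable (τ e)) (hindep : iIndepFun τ P)
    {r B c₀ A ε : ℝ} (hr : 0 < r) (hr1 : r ≤ 1) (hB : 0 < B) (hc₀ : 0 < c₀) (hA : 0 < A)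
    (hε : 0 < ε) :
    ∃ c : ℝ, 0 < c ∧ ∀ (κ : Type) (s : Finset κ) (S : κ → Set ι),
      (∀ i ∈ s, ∀ j ∈ s, i ≠ j → Disjoint (S i) (S j)) → ∀ (Y : κ → Ω → ℝ) (m a : ℝ), 1 ≤ m →
      (∀ i ∈ s, Measurable[sigmaOn τ (S i)] (Y i)) → (∀ i ∈ s, ∀ ω, 0 ≤ Y i ω) →
      (∀ i ∈ s, ∀ ω, Y i ω ≤ B * m) → (∀ i ∈ s, ∫ ω, Y i ω ∂P ≤ a) →
      (∀ i ∈ s, ∫⁻ ω, ENNReal.ofReal (Real.exp (c₀ * Y i ω ^ r)) ∂P ≤ ENNReal.ofReal A) →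
      P.real {ω | s.card * (a + ε) ≤ ∑ i ∈ s, Y i ω} ≤
        Real.exp (-c * s.card * m ^ (r - 1)) := by
  obtain ⟨C, hC, hCle⟩ := pow_le_exp_rpow hr (half_pos hc₀) 2 two_pos
  -- The first condition bounds `θ Y` by `(c₀ / 2) Y ^ r`, the second one makes the second order
  -- term of the moment generating function small against `ε θ`.
  obtain ⟨c₁, hc₁, hc₁B, hc₁A⟩ :
      ∃ c₁ : ℝ, 0 < c₁ ∧ c₁ * B ^ (1 - r) ≤ c₀ / 2 ∧ c₁ * (C * A) ≤ ε / 2 := by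
    refine ⟨min (c₀ / 2 / B ^ (1 - r)) (ε / 2 / (C * A)), by positivity, ?_, ?_⟩
    · rw [← le_div_iff₀ (by positivity)]; exact min_le_left _ _
    · rw [← le_div_iff₀ (by positivity)]; exact min_le_right _ _
  refine ⟨c₁ * (ε / 2), by positivity, fun κ s S hS Y m a hm hYm hY0 hYB hYa hYA => ?_⟩
  have hm0 : 0 < m := by linarith
  set θ := c₁ * m ^ (r - 1)
  have hθ : 0 < θ := by positivity
  have hθc : θ ≤ c₁ := by
    refine mul_le_of_le_one_right hc₁.le ?_
    exact Real.rpow_le_one_of_one_le_of_nonpos hm (by linarith)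
  -- This is where the truncation enters: `Y = Y ^ (1 - r) * Y ^ r ≤ (B m) ^ (1 - r) * Y ^ r`.
  have hθY : ∀ i ∈ s, ∀ ω, θ * Y i ω ≤ c₀ / 2 * Y i ω ^ r := by
    intro i hi ω
    have h0 := hY0 i hi ω
    have h1 : Y i ω = Y i ω ^ (1 - r) * Y i ω ^ r := by
      rw [← Real.rpow_add' h0 (by simp), sub_add_cancel, Real.rpow_one]
    have h2 : Y i ω ^ (1 - r) ≤ B ^ (1 - r) * m ^ (1 - r) := by
      rw [← Real.mul_rpow hB.le hm0.le]
      exact Real.rpow_le_rpow h0 (hYB i hi ω) (by linarith)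
    have h3 : m ^ (r - 1) * m ^ (1 - r) = 1 := by
      rw [← Real.rpow_add hm0]; simp
    calc θ * Y i ω = θ * (Y i ω ^ (1 - r) * Y i ω ^ r) := by rw [← h1]
      _ ≤ θ * (B ^ (1 - r) * m ^ (1 - r) * Y i ω ^ r) := by
          have := Real.rpow_nonneg h0 r
          gcongr
      _ = (c₁ * B ^ (1 - r)) * Y i ω ^ r * (m ^ (r - 1) * m ^ (1 - r)) := by
          simp only [θ]; ring
      _ ≤ _ := by
          rw [h3, mul_one]
          have := Real.rpow_nonneg h0 r
          gcongr
  have hYmeas : ∀ i ∈ s, Measurable (Y i) := fun i hi =>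
    (hYm i hi).mono (sigmaOn_le hmeas _) le_rfl
  have hmgf : ∀ i ∈ s, ∫⁻ ω, ENNReal.ofReal (Real.exp (θ * Y i ω)) ∂P ≤
      ENNReal.ofReal (Real.exp (θ * a + θ ^ 2 * (C * A))) := by
    intro i hi
    have hpt : ∀ ω, Real.exp (θ * Y i ω) ≤
        1 + θ * Y i ω + θ ^ 2 * C * Real.exp (c₀ * Y i ω ^ r) := by
      intro ω
      have h0 := hY0 i hi ω
      refine (exp_le_one_add_add_sq_mul (by positivity)).trans ?_
      have h1 : (θ * Y i ω) ^ 2 * Real.exp (θ * Y i ω) ≤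
          θ ^ 2 * (C * Real.exp (c₀ / 2 * Y i ω ^ r)) * Real.exp (c₀ / 2 * Y i ω ^ r) := by
        rw [mul_pow]
        have := hCle _ h0
        have := hθY i hi ω
        gcongr
      have h2 : θ ^ 2 * (C * Real.exp (c₀ / 2 * Y i ω ^ r)) * Real.exp (c₀ / 2 * Y i ω ^ r) =
          θ ^ 2 * C * Real.exp (c₀ * Y i ω ^ r) := by
        rw [mul_assoc, mul_assoc, ← Real.exp_add, mul_assoc]
        congr 3; ring_nf
      linarith
    have hIe : Integrable (fun ω => Real.exp (c₀ * Y i ω ^ r)) P :=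
      integrable_of_lintegral_exp_ne_top (hYmeas i hi)
        (ne_top_of_le_ne_top ENNReal.ofReal_ne_top (hYA i hi))
    have hIeA : ∫ ω, Real.exp (c₀ * Y i ω ^ r) ∂P ≤ A := by
      have := hYA i hi
      rwa [← ofReal_integral_eq_lintegral_ofReal hIe (ae_of_all _ fun ω => (Real.exp_pos _).le),
        ENNReal.ofReal_le_ofReal_iff hA.le] at this
    have hIY : Integrable (Y i) P := (integrable_const (B * m)).mono'
      (hYmeas i hi).aestronglyMeasurable (ae_of_all _ fun ω => by
        rw [Real.norm_of_nonneg (hY0 i hi ω)]; exact hYB i hi ω)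
    have hI1 : Integrable (fun ω => 1 + θ * Y i ω) P := (integrable_const _).add (hIY.const_mul θ)
    have hI : Integrable (fun ω => 1 + θ * Y i ω + θ ^ 2 * C * Real.exp (c₀ * Y i ω ^ r)) P :=
      hI1.add (hIe.const_mul _)
    refine (lintegral_mono fun ω => ENNReal.ofReal_le_ofReal (hpt ω)).trans ?_
    rw [← ofReal_integral_eq_lintegral_ofReal hI (ae_of_all _ fun ω =>
      (Real.exp_pos _).le.trans (hpt ω))]
    apply ENNReal.ofReal_le_ofReal
    rw [integral_add hI1 (hIe.const_mul _), integral_add (integrable_const _) (hIY.const_mul θ),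
      integral_const_mul, integral_const_mul]
    simp only [integral_const, probReal_univ, smul_eq_mul, mul_one]
    have h1 := mul_le_mul_of_nonneg_left (hYa i hi) hθ.le
    have h2 := mul_le_mul_of_nonneg_left hIeA (by positivity : 0 ≤ θ ^ 2 * C)
    have h3 := Real.add_one_le_exp (θ * a + θ ^ 2 * (C * A))
    linarith
  have h := prob_le_sum_le_exp hmeas hindep s S hS (fun i ω => θ * Y i ω)
    (fun i hi => (hYm i hi).const_mul θ) (t := θ * (s.card * (a + ε))) hmgf
  have hset : {ω | s.card * (a + ε) ≤ ∑ i ∈ s, Y i ω} =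
      {ω | θ * (s.card * (a + ε)) ≤ ∑ i ∈ s, θ * Y i ω} := by
    ext ω
    change s.card * (a + ε) ≤ ∑ i ∈ s, Y i ω ↔ θ * (s.card * (a + ε)) ≤ ∑ i ∈ s, θ * Y i ω
    rw [← Finset.mul_sum, mul_le_mul_iff_right₀ hθ]
  rw [hset]
  refine h.trans (Real.exp_le_exp.2 ?_)
  have h1 : θ * (C * A) ≤ ε / 2 := (mul_le_mul_of_nonneg_right hθc (by positivity)).trans hc₁A
  have h2 : (s.card : ℝ) * θ * (θ * (C * A)) ≤ s.card * θ * (ε / 2) := by gcongr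
  calc (s.card : ℝ) * (θ * a + θ ^ 2 * (C * A)) - θ * (s.card * (a + ε))
      = s.card * θ * (θ * (C * A)) - s.card * θ * ε := by ring
    _ ≤ s.card * θ * (ε / 2) - s.card * θ * ε := by linarith
    _ = _ := by simp only [θ]; ring

end chernoff

/-! ### Passage times along finitely many paths -/

section blocks

variable {d : ℕ} {Ω : Type*} [MeasurableSpace Ω] {P : Measure Ω} [IsProbabilityMeasure P]
  {τ : Edge d → Ω → ℝ} {M : ℝ}

/-- The edges contained in the cube of radius `W` around `y`. -/
def cubeEdges (y : Fin d → ℤ) (W : ℤ) : Set (Edge d) :=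
  {e | ∀ z ∈ e.1, ∀ i, |z i - y i| ≤ W}

lemma disjoint_cubeEdges {y y' : Fin d → ℤ} {W : ℤ} (h : ∃ i, 2 * W < |y i - y' i|) :
    Disjoint (cubeEdges y W) (cubeEdges y' W) := by
  obtain ⟨i, hi⟩ := h
  rw [Set.disjoint_left]
  intro e h1 h2
  have h3 := h1 _ e.1.out_fst_mem i
  have h4 := h2 _ e.1.out_fst_mem i
  rw [abs_le] at h3 h4
  rcases abs_cases (y i - y' i) with h | h <;> omega

/-- The passage time of a path of length at most `N` is at most `N` times its largest weight, so its
stretched exponential moments are controlled by those of single weights. -/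
lemma exp_pathTime_le {w : Edge d → ℝ} (hw : ∀ e, 0 ≤ w e) {u v : Fin d → ℤ}
    (p : (latticeGraph d).Walk u v) {N c c₀ r : ℝ} (hr : 0 < r) (hN : p.length ≤ N) (hc₀ : 0 ≤ c₀)
    (hc : c₀ * N ^ r ≤ c) :
    Real.exp (c₀ * pathTime w p ^ r) ≤
      1 + ((edgeList p).map fun e => Real.exp (c * w e ^ r)).sum := by
  have hN0 : 0 ≤ N := (Nat.cast_nonneg _).trans hN
  rw [pathTime_eq_sum]
  rw [← length_edgeList] at hN
  generalize edgeList p = l at hN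
  have hsum0 : 0 ≤ (l.map fun e => Real.exp (c * w e ^ r)).sum := List.sum_nonneg fun y hy => by
    obtain ⟨e, -, rfl⟩ := List.mem_map.1 hy
    exact (Real.exp_pos _).le
  rcases eq_or_ne l [] with rfl | hl
  · simp [Real.zero_rpow hr.ne']
  · obtain ⟨e, he, hmax⟩ := l.toFinset.exists_max_image w (List.toFinset_nonempty_iff l |>.2 hl)
    have h1 : (l.map w).sum ≤ N * w e := by
      have := List.sum_le_card_nsmul (l.map w) (w e) (fun y hy => by
        obtain ⟨e', he', rfl⟩ := List.mem_map.1 hy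
        exact hmax e' (List.mem_toFinset.2 he'))
      rw [nsmul_eq_mul, List.length_map] at this
      exact this.trans (mul_le_mul_of_nonneg_right hN (hw e))
    have h0 : 0 ≤ (l.map w).sum := List.sum_nonneg fun y hy => by
      obtain ⟨e, -, rfl⟩ := List.mem_map.1 hy
      exact hw e
    have h2 : (l.map w).sum ^ r ≤ N ^ r * w e ^ r := by
      rw [← Real.mul_rpow hN0 (hw e)]
      exact Real.rpow_le_rpow h0 h1 hr.le
    have h3 : c₀ * (l.map w).sum ^ r ≤ c * w e ^ r := by
      have := Real.rpow_nonneg (hw e) r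
      calc _ ≤ c₀ * (N ^ r * w e ^ r) := by gcongr
        _ = c₀ * N ^ r * w e ^ r := by ring
        _ ≤ _ := by gcongr
    have h4 : Real.exp (c * w e ^ r) ≤ (l.map fun e => Real.exp (c * w e ^ r)).sum := by
      refine List.single_le_sum (fun y hy => ?_) _ (List.mem_map.2 ⟨e, List.mem_toFinset.1 he, rfl⟩)
      obtain ⟨e, -, rfl⟩ := List.mem_map.1 hy
      exact (Real.exp_pos _).le
    linarith [Real.exp_le_exp.2 h3]

lemma measurable_finset_inf' {Ω κ : Type*} {m : MeasurableSpace Ω} {Q : Finset κ} (hQ : Q.Nonempty)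
    {f : κ → Ω → ℝ} (hf : ∀ p ∈ Q, Measurable (f p)) :
    Measurable fun ω => Q.inf' hQ fun p => f p ω := by
  induction hQ using Finset.Nonempty.cons_induction with
  | singleton p => simpa using hf p (by simp)
  | cons p Q hp hQ ih =>
    simp only [Finset.inf'_cons hQ]
    exact (hf p (by simp)).inf (ih fun p' hp' => hf p' (by simp [hp']))

lemma exists_walk_bound (V : Finset (Fin d → ℤ)) (Q : ∀ v, Finset ((latticeGraph d).Walk 0 v))
    (g : ∀ v, (latticeGraph d).Walk 0 v → ℕ) : ∃ N : ℕ, ∀ v ∈ V, ∀ p ∈ Q v, g v p ≤ N :=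
  ⟨V.sup fun v => (Q v).sup (g v), fun v hv _ hp =>
    (Finset.le_sup (f := g v) hp).trans (Finset.le_sup (f := fun v => (Q v).sup (g v)) hv)⟩

lemma abs_le_sum_of_mem_support {u v : Fin d → ℤ} (p : (latticeGraph d).Walk u v) {z : Fin d → ℤ}
    (hz : z ∈ p.support) (i : Fin d) :
    |z i| ≤ ((p.support.map fun z => ∑ i, (z i).natAbs).sum : ℕ) := by
  rw [Int.abs_eq_natAbs]
  have h1 : (z i).natAbs ≤ ∑ i, (z i).natAbs :=
    Finset.single_le_sum (f := fun i => (z i).natAbs) (fun i _ => Nat.zero_le _) (Finset.mem_univ i)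
  have h2 : ∑ i, (z i).natAbs ≤ (p.support.map fun z => ∑ i, (z i).natAbs).sum :=
    List.single_le_sum (fun y _ => Nat.zero_le y) _ (List.mem_map.2 ⟨z, hz, rfl⟩)
  exact_mod_cast h1.trans h2

namespace IIDWeights

omit [IsProbabilityMeasure P] in
/-- Finitely many paths suffice to approximate the mean passage time. -/
lemma exists_finset_walks (H : IIDWeights P τ M) (v : Fin d → ℤ) {ε : ℝ} (hε : 0 < ε) :
    ∃ (Q : Finset ((latticeGraph d).Walk 0 v)) (hQ : Q.Nonempty),
      ∫ ω, Q.inf' hQ (fun p => pathTime (fun e => τ e ω) p) ∂P ≤ meanTime P τ v + ε := by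
  classical
  obtain ⟨f, hf⟩ := exists_surjective_nat ((latticeGraph d).Walk 0 v)
  have hne : ∀ n : ℕ, ((Finset.range (n + 1)).image f).Nonempty := fun n =>
    (Finset.nonempty_range_iff.2 n.succ_ne_zero).image f
  set X : ℕ → Ω → ℝ := fun n ω =>
    ((Finset.range (n + 1)).image f).inf' (hne n) fun p => pathTime (fun e => τ e ω) p
  have hmem : ∀ n k, k ≤ n → f k ∈ (Finset.range (n + 1)).image f := fun n k hk =>
    Finset.mem_image_of_mem f (Finset.mem_range.2 (by omega))
  have hX0 : ∀ n ω, 0 ≤ X n ω := fun n ω =>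
    Finset.le_inf' _ _ fun p _ => pathTime_nonneg (fun e => H.nonneg e ω) p
  have hXle : ∀ n k ω, k ≤ n → X n ω ≤ pathTime (fun e => τ e ω) (f k) := fun n k ω hk =>
    Finset.inf'_le _ (hmem n k hk)
  have hXm : ∀ n, Measurable (X n) := fun n =>
    measurable_finset_inf' (hne n) fun p _ => measurable_pathTime p fun e _ => H.meas e
  have hint : Integrable (fun ω => pathTime (fun e => τ e ω) (f 0)) P := by
    simp only [pathTime_eq_sum]
    exact (integral_list_sum_le H.integrable H.integral_le _).1
  have hlim : Tendsto (fun n => ∫ ω, X n ω ∂P) atTop (𝓝 (meanTime P τ v)) := by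
    refine tendsto_integral_of_dominated_convergence _ (fun n => (hXm n).aestronglyMeasurable) hint
      (fun n => ae_of_all _ fun ω => ?_) (ae_of_all _ fun ω => ?_)
    · rw [Real.norm_of_nonneg (hX0 n ω)]
      exact hXle n 0 ω (Nat.zero_le n)
    · refine tendsto_order.2
        ⟨fun a ha => Eventually.of_forall fun n => ha.trans_le ?_, fun a ha => ?_⟩
      · exact Finset.le_inf' _ _ fun p _ => latticeTime_le_pathTime (fun e => H.nonneg e ω) p
      · obtain ⟨p, hp⟩ := exists_lt_of_ciInf_lt ha
        obtain ⟨k, rfl⟩ := hf p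
        filter_upwards [eventually_ge_atTop k] with n hn
        exact (hXle n k ω hn).trans_lt hp
  obtain ⟨n, hn⟩ := (hlim.eventually (gt_mem_nhds (show meanTime P τ v < meanTime P τ v + ε by
    linarith))).exists
  exact ⟨_, hne n, hn.le⟩

/-- Local upper bounds `X y v` of the passage times from `y` to `y + v`, for finitely many
displacements `v`: they only depend on the edges in a cube around `y`, their means are nearly those
of the passage times, and they have uniform stretched exponential moments. -/
lemma exists_local_times (H : IIDWeights P τ M) {r c A : ℝ} (hr : 0 < r) (hc : 0 < c) (hA : 0 ≤ A)
    (hexp : ∀ e, ∫⁻ ω, ENNReal.ofReal (Real.exp (c * τ e ω ^ r)) ∂P ≤ ENNReal.ofReal A)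
    (V : Finset (Fin d → ℤ)) {ε : ℝ} (hε : 0 < ε) :
    ∃ (X : (Fin d → ℤ) → (Fin d → ℤ) → Ω → ℝ) (W : ℤ) (c₀ A₀ : ℝ), 0 < c₀ ∧ 0 < A₀ ∧ 0 ≤ W ∧
      ∀ v ∈ V, ∀ y, Measurable[sigmaOn τ (cubeEdges y W)] (X y v) ∧
        (∀ ω, latticeTime (fun e => τ e ω) y (y + v) ≤ X y v ω) ∧
        Integrable (X y v) P ∧ ∫ ω, X y v ω ∂P ≤ meanTime P τ v + ε ∧
        ∫⁻ ω, ENNReal.ofReal (Real.exp (c₀ * X y v ω ^ r)) ∂P ≤ ENNReal.ofReal A₀ := by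
  choose Q hQ hQm using fun v => H.exists_finset_walks v hε
  obtain ⟨W, hW'⟩ :=
    exists_walk_bound V Q fun v p => (p.support.map fun z => ∑ i, (z i).natAbs).sum
  obtain ⟨N', hN'⟩ := exists_walk_bound V Q fun v p => p.length
  have hW : ∀ v ∈ V, ∀ p ∈ Q v, ∀ z ∈ p.support, ∀ i, |z i| ≤ (W : ℤ) := fun v hv p hp z hz i =>
    (abs_le_sum_of_mem_support p hz i).trans (by exact_mod_cast hW' v hv p hp)
  obtain ⟨N, hN0, hN⟩ : ∃ N : ℝ, 0 < N ∧ ∀ v ∈ V, ∀ p ∈ Q v, (p.length : ℝ) ≤ N :=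
    ⟨N' + 1, by positivity, fun v hv p hp => by
      have : (p.length : ℝ) ≤ N' := by exact_mod_cast hN' v hv p hp
      linarith⟩
  set F : (v : Fin d → ℤ) → (Edge d → ℝ) → ℝ := fun v w => (Q v).inf' (hQ v) (pathTime w)
  refine ⟨fun y v ω => F v fun e => τ (shiftEdge y e) ω, W, c / N ^ r, 1 + N * A, by positivity,
    by positivity, Nat.cast_nonneg W, fun v hv y => ?_⟩
  have hFmeas : ∀ {m : MeasurableSpace Ω} (σ : Edge d → Ω → ℝ),
      (∀ p ∈ Q v, ∀ e ∈ edgeList p, Measurable (σ e)) → Measurable fun ω => F v fun e => σ e ω := by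
    intro m σ hσ
    exact measurable_finset_inf' (hQ v) fun p hp => measurable_pathTime p (hσ p hp)
  have hF0 : ∀ ω, 0 ≤ F v fun e => τ (shiftEdge y e) ω := fun ω =>
    Finset.le_inf' _ _ fun p _ => pathTime_nonneg (fun e => H.nonneg _ ω) p
  obtain ⟨p₀, hp₀⟩ := hQ v
  have hFle : ∀ ω, (F v fun e => τ (shiftEdge y e) ω) ≤
      pathTime (fun e => τ (shiftEdge y e) ω) p₀ := fun ω => Finset.inf'_le _ hp₀
  have hm : Measurable fun ω => F v fun e => τ (shiftEdge y e) ω :=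
    hFmeas _ fun p _ e _ => H.meas _
  refine ⟨?_, fun ω => ?_, ?_, ?_, ?_⟩
  · refine hFmeas _ fun p hp e he => measurable_sigmaOn ?_
    intro z hz i
    obtain ⟨z', hz', rfl⟩ := Sym2.mem_map.1 hz
    simpa using hW v hv p hp z' (mem_support_of_mem_edgeList p he hz') i
  · refine Finset.le_inf' _ _ fun p _ => ?_
    have := latticeTime_le_pathTime_shift (fun e => H.nonneg e ω) y p
    rwa [zero_add, add_comm] at this
  · have h1 : Integrable (fun ω => pathTime (fun e => τ (shiftEdge y e) ω) p₀) P := by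
      simp only [pathTime_eq_sum]
      exact (integral_list_sum_le (f := fun e => τ (shiftEdge y e)) (fun e => H.integrable _)
        (fun e => H.integral_le _) _).1
    exact h1.mono' hm.aestronglyMeasurable (ae_of_all _ fun ω => by
      rw [Real.norm_of_nonneg (hF0 ω)]; exact hFle ω)
  · refine le_of_eq_of_le ?_ (hQm v)
    refine integral_comp_injective H.meas H.indep H.ident (shiftEdge_injective y) (G := F v) ?_
    exact measurable_finset_inf' (hQ v) fun p _ =>
      measurable_pathTime (τ := fun e (w : Edge d → ℝ) => w e) p fun e _ => measurable_pi_apply e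
  · have h1 : ∀ ω, Real.exp (c / N ^ r * (F v fun e => τ (shiftEdge y e) ω) ^ r) ≤
        1 + ((edgeList p₀).map fun e => Real.exp (c * τ (shiftEdge y e) ω ^ r)).sum := by
      intro ω
      refine le_trans (Real.exp_le_exp.2 ?_) (exp_pathTime_le (w := fun e => τ (shiftEdge y e) ω)
        (fun e => H.nonneg _ ω) p₀ hr (hN v hv p₀ hp₀) (by positivity : 0 ≤ c / N ^ r)
        (div_mul_cancel₀ c (by positivity)).le)
      gcongr
      · exact hF0 ω
      · exact hFle ω
    have hIe : ∀ e, Integrable (fun ω => Real.exp (c * τ (shiftEdge y e) ω ^ r)) P := fun e =>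
      integrable_of_lintegral_exp_ne_top (H.meas _)
        (ne_top_of_le_ne_top ENNReal.ofReal_ne_top (hexp (shiftEdge y e)))
    have hIeA : ∀ e, ∫ ω, Real.exp (c * τ (shiftEdge y e) ω ^ r) ∂P ≤ A := by
      intro e
      have := hexp (shiftEdge y e)
      rwa [← ofReal_integral_eq_lintegral_ofReal (hIe e)
        (ae_of_all _ fun ω => (Real.exp_pos _).le), ENNReal.ofReal_le_ofReal_iff hA] at this
    obtain ⟨h2, h3⟩ := integral_list_sum_le hIe hIeA (edgeList p₀)
    refine (lintegral_mono fun ω => ENNReal.ofReal_le_ofReal (h1 ω)).trans ?_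
    have h4 : Integrable (fun ω => 1 +
        ((edgeList p₀).map fun e => Real.exp (c * τ (shiftEdge y e) ω ^ r)).sum) P :=
      (integrable_const 1).add h2
    rw [← ofReal_integral_eq_lintegral_ofReal h4 (ae_of_all _ fun ω =>
      (Real.exp_pos _).le.trans (h1 ω))]
    apply ENNReal.ofReal_le_ofReal
    rw [integral_add (integrable_const _) h2]
    simp only [integral_const, probReal_univ, smul_eq_mul, mul_one]
    rw [length_edgeList] at h3
    have := mul_le_mul_of_nonneg_right (hN v hv p₀ hp₀) hA
    linarith

end IIDWeights

end blocks

/-! ### Disjoint tubes -/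

section tubes

variable {d : ℕ}

lemma abs_floor_sub_floor_sub_lt (s t : ℝ) : |((⌊s⌋ : ℤ) : ℝ) - ⌊t⌋ - (s - t)| < 1 := by
  have h1 := Int.floor_le s
  have h2 := Int.lt_floor_add_one s
  have h3 := Int.floor_le t
  have h4 := Int.lt_floor_add_one t
  rw [abs_lt]
  constructor <;> linarith

/-- Points along the direction `x` whose indices differ by at least `q`, or which lie on translates
of the line by different multiples of `D e_a`, are more than `2W` apart: in the first case the
coordinate `b` separates them, in the second case the coordinate `a`. -/
lemma exists_coord_separated {x : Fin d → ℝ} {a b : Fin d} (hab : a ≠ b) {L s : ℝ}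
    (hL : 0 < L) (hLs : L ≤ s) (hsL : s ≤ 2 * L) {W : ℤ} {q D : ℕ}
    (hq : 2 * W + 2 ≤ q * L * |x b|) (hD : 2 * W + q * (2 * L) * |x a| + 2 ≤ D) {σ : ℤ}
    (hσ : |σ| = 1) (u : Fin d → ℤ) {i i' k k' : ℕ}
    (h : i ≠ i' ∨ (q : ℤ) ≤ |(k : ℤ) - k'|) :
    ∃ j, 2 * W < |(u + Pi.single a (σ * i * D) + latticeFloor (((k : ℝ) * s) • x) : Fin d → ℤ) j -
      (u + Pi.single a (σ * i' * D) + latticeFloor (((k' : ℝ) * s) • x) : Fin d → ℤ) j| := by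
  have hs : 0 < s := hL.trans_le hLs
  have hfl : ∀ j, |((⌊(k : ℝ) * s * x j⌋ : ℤ) : ℝ) - ⌊(k' : ℝ) * s * x j⌋ -
      ((k : ℝ) - k') * s * x j| < 1 := fun j => by
    have := abs_floor_sub_floor_sub_lt ((k : ℝ) * s * x j) ((k' : ℝ) * s * x j)
    rwa [← sub_mul, ← sub_mul] at this
  by_cases hk : (q : ℤ) ≤ |(k : ℤ) - k'|
  · refine ⟨b, ?_⟩
    have hk' : (q : ℝ) ≤ |(k : ℝ) - k'| := by exact_mod_cast hk
    have h1 := hfl b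
    have h2 : 2 * (W : ℝ) + 2 ≤ |((k : ℝ) - k') * s * x b| := by
      rw [abs_mul, abs_mul, abs_of_pos hs]
      exact hq.trans (by gcongr)
    have h3 := abs_sub_abs_le_abs_sub (((k : ℝ) - k') * s * x b)
      (((⌊(k : ℝ) * s * x b⌋ : ℤ) : ℝ) - ⌊(k' : ℝ) * s * x b⌋)
    rw [abs_sub_comm] at h1
    have h4 : 2 * (W : ℝ) < |((⌊(k : ℝ) * s * x b⌋ : ℤ) : ℝ) - ⌊(k' : ℝ) * s * x b⌋| := by
      linarith
    have h5 : 2 * W < |⌊(k : ℝ) * s * x b⌋ - ⌊(k' : ℝ) * s * x b⌋| := by exact_mod_cast h4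
    simpa [latticeFloor, Pi.single_eq_of_ne hab.symm] using h5
  · have hii : i ≠ i' := h.resolve_right hk
    refine ⟨a, ?_⟩
    have hk' : |(k : ℝ) - k'| ≤ q := by exact_mod_cast (not_le.1 hk).le
    have h1 := hfl a
    have h2 : |((k : ℝ) - k') * s * x a| ≤ q * (2 * L) * |x a| := by
      rw [abs_mul, abs_mul, abs_of_pos hs]
      gcongr
    have h3 := abs_sub_abs_le_abs_sub (((⌊(k : ℝ) * s * x a⌋ : ℤ) : ℝ) - ⌊(k' : ℝ) * s * x a⌋)
      (((k : ℝ) - k') * s * x a)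
    have h4 : (D : ℝ) ≤ |(σ : ℝ) * i * D - σ * i' * D| := by
      have h6 : (1 : ℤ) ≤ |(i : ℤ) - i'| := Int.one_le_abs (by omega)
      have h7 : (1 : ℝ) ≤ |(i : ℝ) - i'| := by exact_mod_cast h6
      have h8 : |(σ : ℝ)| = 1 := by exact_mod_cast hσ
      rw [← sub_mul, ← mul_sub, abs_mul, abs_mul, h8, one_mul, Nat.abs_cast]
      nlinarith [(Nat.cast_nonneg D : (0 : ℝ) ≤ D)]
    set y : ℝ := ((⌊(k : ℝ) * s * x a⌋ : ℤ) : ℝ) - ⌊(k' : ℝ) * s * x a⌋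
    have h5 := abs_sub_abs_le_abs_sub ((σ : ℝ) * i * D - σ * i' * D) (-y)
    rw [abs_neg, sub_neg_eq_add] at h5
    have h6 : 2 * (W : ℝ) < |((σ : ℝ) * i * D - σ * i' * D) + y| := by linarith
    have h7 : 2 * W < |(σ * i * D - σ * i' * D) +
        (⌊(k : ℝ) * s * x a⌋ - ⌊(k' : ℝ) * s * x a⌋)| := by
      simp only [y] at h6
      exact_mod_cast h6
    convert h7 using 2
    simp only [latticeFloor, Pi.add_apply, Pi.single_eq_same, Pi.smul_apply, smul_eq_mul]
    ring

lemma sum_range_mul_eq {q : ℕ} (f : ℕ → ℝ) (m : ℕ) :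
    ∑ k ∈ Finset.range (q * m), f k =
      ∑ j ∈ Finset.range q, ∑ l ∈ Finset.range m, f (q * l + j) := by
  induction m with
  | zero => simp
  | succ m ih =>
    rw [Nat.mul_succ, Finset.sum_range_add, ih, ← Finset.sum_add_distrib]
    exact Finset.sum_congr rfl fun j _ => (Finset.sum_range_succ _ _).symm

variable {Ω : Type*} [MeasurableSpace Ω] {P : Measure Ω} [IsProbabilityMeasure P]
  {τ : Edge d → Ω → ℝ} {M : ℝ}

namespace IIDWeights

/-- Beyond a scale `L`, the mean passage time of a displacement in direction `x` is close to its
limit, uniformly in the starting point. -/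
lemma exists_scale (H : IIDWeights P τ M) (x : Fin d → ℝ) {ε : ℝ} (hε : 0 < ε) :
    ∃ L : ℕ, 1 ≤ L ∧ ∀ s : ℝ, L ≤ s → ∀ t : ℝ,
      meanTime P τ (latticeFloor ((t + s) • x) - latticeFloor (t • x)) ≤
        s * (timeConstant P τ x + 2 * ε) := by
  set μ := timeConstant P τ x
  have h1 := (H.tendsto_meanPassageTime x).eventually (gt_mem_nhds (show μ < μ + ε by linarith))
  obtain ⟨T, hT⟩ := eventually_atTop.1 h1
  obtain ⟨L, hL⟩ := exists_nat_ge (max T (max 1 (d * M / ε)))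
  have hL1 : (1 : ℝ) ≤ L := (le_max_left _ _).trans ((le_max_right _ _).trans hL)
  refine ⟨L, by exact_mod_cast hL1, fun s hs t => ?_⟩
  have h2 := hT s ((le_max_left _ _).trans (hL.trans hs))
  have h3 : d * M / ε ≤ s := (le_max_right _ _).trans ((le_max_right _ _).trans (hL.trans hs))
  rw [meanPassageTime_eq, inv_mul_lt_iff₀ (by linarith)] at h2
  rw [div_le_iff₀ hε] at h3
  have h4 := H.meanTime_increment_le x t s
  linarith

/-- The tubes in direction `x` that start at `K` points `D e_a` apart are all slow with a
probability at most `C exp (-c K n ^ r)`, where `c`, `C` and `D` do not depend on `K`. -/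
lemma exists_tubes (H : IIDWeights P τ M) {r c' A : ℝ} (hr : 0 < r) (hr1 : r ≤ 1) (hc' : 0 < c')
    (hA : 0 ≤ A)
    (hexp : ∀ e, ∫⁻ ω, ENNReal.ofReal (Real.exp (c' * τ e ω ^ r)) ∂P ≤ ENNReal.ofReal A)
    {x : Fin d → ℝ} {a b : Fin d} (hab : a ≠ b) (hb : x b ≠ 0) {ε : ℝ} (hε : 0 < ε) :
    ∃ (c C : ℝ) (D : ℕ), 0 < c ∧ 0 < C ∧ ∀ K : ℕ, ∀ᶠ n : ℕ in atTop, ∀ (u : Fin d → ℤ) (σ : ℤ),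
      |σ| = 1 →
      P.real {ω | ∀ i < K, (n : ℝ) * (timeConstant P τ x + 5 * ε) <
        latticeTime (fun e => τ e ω) (u + Pi.single a (σ * i * D))
          (u + Pi.single a (σ * i * D) + latticeFloor ((n : ℝ) • x))} ≤
        C * Real.exp (-c * K * (n : ℝ) ^ r) := by
  set μ := timeConstant P τ x
  have hμ : 0 ≤ μ := H.timeConstant_nonneg x
  obtain ⟨L, hL1, hL⟩ := H.exists_scale x hε
  have hL1' : (1 : ℝ) ≤ L := by exact_mod_cast hL1
  set V : Finset (Fin d → ℤ) := Fintype.piFinset fun i =>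
    Finset.Icc (-(⌈2 * L * |x i|⌉ + 1)) (⌈2 * L * |x i|⌉ + 1)
  obtain ⟨X, W, c₀, A₀, hc₀, hA₀, hW, hX⟩ := H.exists_local_times hr hc' hA hexp V hε
  have hb' : 0 < |x b| := abs_pos.2 hb
  -- Blocks of a tube whose indices differ by `q` or more have disjoint cubes.
  obtain ⟨q, hq⟩ := exists_nat_ge ((2 * W + 2) / (L * |x b|))
  have hW' : (0 : ℝ) ≤ W := by exact_mod_cast hW
  rw [div_le_iff₀ (by positivity), ← mul_assoc] at hq
  have hq0 : 0 < q := Nat.pos_of_ne_zero fun h => by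
    rw [h] at hq
    simp only [Nat.cast_zero, zero_mul] at hq
    linarith
  have hq0' : (1 : ℝ) ≤ q := by exact_mod_cast hq0
  obtain ⟨D, hD⟩ := exists_nat_ge (2 * W + q * (2 * L) * |x a| + 2)
  set B : ℝ := q * (2 * L * (μ + 3 * ε) + ε)
  have hB : 0 < B := by positivity
  obtain ⟨c, hc, hchern⟩ :=
    exists_prob_truncated_sum_le (P := P) H.meas H.indep hr hr1 hB hc₀ hA₀ hε
  refine ⟨c * (1 / (2 * q * L)) ^ r, q, D, by positivity, by positivity, fun K => ?_⟩
  filter_upwards [eventually_ge_atTop (2 * q * L)] with n hn u σ hσ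
  -- The way to `⌊n x⌋` is cut into `q m` blocks of length `s ∈ [L, 2L]`.
  set m := n / (q * L)
  have hqL : 0 < q * L := by positivity
  have hm : 1 ≤ m := (Nat.one_le_div_iff hqL).2 (by nlinarith)
  have hm' : (1 : ℝ) ≤ m := by exact_mod_cast hm
  have hnm1 : (q * L * m : ℝ) ≤ n := by exact_mod_cast Nat.mul_div_le n (q * L)
  have hnm2 : (n : ℝ) ≤ q * L * (2 * m) := by
    have h1 : n < q * L * (m + 1) := Nat.lt_mul_div_succ n hqL
    have h2 : n ≤ q * L * (2 * m) := h1.le.trans (Nat.mul_le_mul_left _ (by omega))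
    exact_mod_cast h2
  have hqm : (0 : ℝ) < q * m := by positivity
  obtain ⟨s, hs⟩ : ∃ s : ℝ, s = n / (q * m) := ⟨_, rfl⟩
  have hns : (q * m : ℝ) * s = n := by rw [hs]; field_simp
  have hLs : L ≤ s := by
    rw [hs, le_div_iff₀ hqm]; linarith
  have hsL : s ≤ 2 * L := by
    rw [hs, div_le_iff₀ hqm]; linarith
  set p : ℕ → Fin d → ℤ := fun k => latticeFloor (((k : ℝ) * s) • x)
  set v : ℕ → Fin d → ℤ := fun k => p (k + 1) - p k
  have hvV : ∀ k, v k ∈ V := by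
    intro k
    rw [Fintype.mem_piFinset]
    intro j
    have h1 := abs_floor_sub_floor_sub_lt (((k + 1 : ℕ) : ℝ) * s * x j) ((k : ℝ) * s * x j)
    have h2 : ((k + 1 : ℕ) : ℝ) * s * x j - (k : ℝ) * s * x j = s * x j := by push_cast; ring
    rw [h2] at h1
    have h3 := abs_sub_abs_le_abs_sub (((⌊((k + 1 : ℕ) : ℝ) * s * x j⌋ : ℤ) : ℝ) -
      ⌊(k : ℝ) * s * x j⌋) (s * x j)
    have h4 : |s * x j| ≤ 2 * L * |x j| := by
      rw [abs_mul, abs_of_nonneg (by linarith)]; gcongr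
    have h5 := Int.le_ceil (2 * L * |x j|)
    have h6 : |(((⌊((k + 1 : ℕ) : ℝ) * s * x j⌋ : ℤ) : ℝ) - ⌊(k : ℝ) * s * x j⌋)| ≤
        ((⌈2 * L * |x j|⌉ + 1 : ℤ) : ℝ) := by
      push_cast; push_cast at h3 h1; linarith
    rw [Finset.mem_Icc, ← abs_le]
    simp only [v, p, latticeFloor, Pi.sub_apply, Pi.smul_apply, smul_eq_mul]
    exact_mod_cast h6
  -- `Z i k` bounds the passage time of the block from `o i + p k` to `o i + p (k + 1)`.
  set o : ℕ → Fin d → ℤ := fun i => u + Pi.single a (σ * i * D)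
  set Z : ℕ → ℕ → Ω → ℝ := fun i k => X (o i + p k) (v k)
  have hZ : ∀ i k, _ := fun i k => hX (v k) (hvV k) (o i + p k)
  have hZ0 : ∀ i k ω, 0 ≤ Z i k ω := fun i k ω =>
    (latticeTime_nonneg (fun e => H.nonneg e ω) _ _).trans ((hZ i k).2.1 ω)
  set a₀ := s * (μ + 3 * ε)
  have hZa : ∀ i k, ∫ ω, Z i k ω ∂P ≤ a₀ := by
    intro i k
    refine (hZ i k).2.2.2.1.trans ?_
    have h1 := hL s hLs (k * s)
    have h2 : (k : ℝ) * s + s = ((k + 1 : ℕ) : ℝ) * s := by push_cast; ring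
    rw [h2] at h1
    have h3 : meanTime P τ (v k) ≤ s * (μ + 2 * ε) := h1
    simp only [a₀]
    nlinarith
  have ha₀ : 0 ≤ a₀ := mul_nonneg (by linarith) (by linarith)
  set t := q * m * (a₀ + ε)
  have ht : 0 < t := by positivity
  have htB : t ≤ B * m := by
    simp only [t, B]
    have : a₀ ≤ 2 * L * (μ + 3 * ε) := by simp only [a₀]; gcongr
    calc (q : ℝ) * m * (a₀ + ε) ≤ q * m * (2 * L * (μ + 3 * ε) + ε) := by gcongr
      _ = _ := by ring
  set Y : ℕ → ℕ → Ω → ℝ := fun i k ω => min (Z i k ω) t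
  have hY0 : ∀ i k ω, 0 ≤ Y i k ω := fun i k ω => le_min (hZ0 i k ω) ht.le
  -- If a tube is slow, its truncated block times still add up to `t`.
  have htube : ∀ i ω, (n : ℝ) * (μ + 5 * ε) < latticeTime (fun e => τ e ω) (o i)
      (o i + latticeFloor ((n : ℝ) • x)) → t ≤ ∑ k ∈ Finset.range (q * m), Y i k ω := by
    intro i ω h
    by_cases hbig : ∃ k ∈ Finset.range (q * m), t ≤ Z i k ω
    · obtain ⟨k, hk, hkt⟩ := hbig
      calc t = Y i k ω := (min_eq_right hkt).symm
        _ ≤ _ := Finset.single_le_sum (f := fun k => Y i k ω) (fun k _ => hY0 i k ω) hk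
    · push Not at hbig
      have h1 : ∑ k ∈ Finset.range (q * m), Y i k ω = ∑ k ∈ Finset.range (q * m), Z i k ω :=
        Finset.sum_congr rfl fun k hk => min_eq_left (hbig k hk).le
      rw [h1]
      have h2 := latticeTime_chain (fun e => H.nonneg e ω) (fun k => o i + p k) (q * m)
      have h3 : o i + p 0 = o i := by
        simp [p, latticeFloor_zero]
      have h4 : p (q * m) = latticeFloor ((n : ℝ) • x) := by
        simp only [p]; push_cast; rw [hns]
      simp only [h3, h4] at h2
      have h5 : ∑ k ∈ Finset.range (q * m), latticeTime (fun e => τ e ω) (o i + p k)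
          (o i + p (k + 1)) ≤ ∑ k ∈ Finset.range (q * m), Z i k ω := by
        refine Finset.sum_le_sum fun k _ => ?_
        have := (hZ i k).2.1 ω
        simp only [v, add_assoc, add_sub_cancel] at this
        simpa only [Z, v, add_assoc] using this
      have h6 : t ≤ n * (μ + 5 * ε) := by
        have h7 : a₀ + ε ≤ s * (μ + 5 * ε) := by simp only [a₀]; nlinarith
        rw [← hns, mul_assoc _ s]
        exact mul_le_mul_of_nonneg_left h7 hqm.le
      linarith
  -- If all tubes are slow, the truncated times of the blocks with indices in one of the residue
  -- classes modulo `q` have a large sum.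
  have hsub : {ω | ∀ i < K, (n : ℝ) * (μ + 5 * ε) < latticeTime (fun e => τ e ω) (o i)
      (o i + latticeFloor ((n : ℝ) • x))} ⊆ ⋃ j ∈ Finset.range q,
      {ω | ((Finset.range K ×ˢ Finset.range m).card : ℝ) * (a₀ + ε) ≤
        ∑ il ∈ Finset.range K ×ˢ Finset.range m, Y il.1 (q * il.2 + j) ω} := by
    intro ω hω
    by_contra hcon
    simp only [Set.mem_iUnion, not_exists] at hcon
    have h1 : ∀ j ∈ Finset.range q, ∑ il ∈ Finset.range K ×ˢ Finset.range m,
        Y il.1 (q * il.2 + j) ω < K * m * (a₀ + ε) := fun j hj => by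
      have h : ¬ (((Finset.range K ×ˢ Finset.range m).card : ℝ) * (a₀ + ε) ≤
        ∑ il ∈ Finset.range K ×ˢ Finset.range m, Y il.1 (q * il.2 + j) ω) := hcon j hj
      simpa using h
    have h2 := Finset.sum_lt_sum_of_nonempty (Finset.nonempty_range_iff.2 hq0.ne') h1
    have h3 : (K : ℝ) * t ≤ ∑ i ∈ Finset.range K, ∑ k ∈ Finset.range (q * m), Y i k ω := by
      have := Finset.card_nsmul_le_sum (Finset.range K)
        (fun i => ∑ k ∈ Finset.range (q * m), Y i k ω) t
        fun i hi => htube i ω (hω i (Finset.mem_range.1 hi))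
      simpa using this
    have h4 : ∑ i ∈ Finset.range K, ∑ k ∈ Finset.range (q * m), Y i k ω =
        ∑ j ∈ Finset.range q, ∑ il ∈ Finset.range K ×ˢ Finset.range m,
          Y il.1 (q * il.2 + j) ω := by
      simp only [sum_range_mul_eq, Finset.sum_product]
      rw [Finset.sum_comm]
    rw [h4] at h3
    simp only [Finset.sum_const, Finset.card_range, nsmul_eq_mul] at h2
    simp only [t] at h3
    nlinarith
  have hj : ∀ j ∈ Finset.range q, P.real {ω | ((Finset.range K ×ˢ Finset.range m).card : ℝ) *
      (a₀ + ε) ≤ ∑ il ∈ Finset.range K ×ˢ Finset.range m, Y il.1 (q * il.2 + j) ω} ≤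
      Real.exp (-(c * (1 / (2 * q * L)) ^ r) * K * (n : ℝ) ^ r) := by
    intro j _
    refine (hchern (ℕ × ℕ) (Finset.range K ×ˢ Finset.range m)
      (fun il => cubeEdges (o il.1 + p (q * il.2 + j)) W) ?_ (fun il => Y il.1 (q * il.2 + j)) m a₀
      hm' ?_ (fun il _ => hY0 _ _) (fun il _ ω => (min_le_right _ _).trans htB) ?_ ?_).trans ?_
    · rintro ⟨i, l⟩ _ ⟨i', l'⟩ _ hne
      refine disjoint_cubeEdges (exists_coord_separated hab (by linarith) hLs hsL hq hD hσ u ?_)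
      by_cases hi : i = i'
      · right
        have hl : l ≠ l' := fun hl => hne (by rw [hi, hl])
        have h1 : (1 : ℤ) ≤ |(l : ℤ) - l'| := Int.one_le_abs (by omega)
        have h2 : ((q * l + j : ℕ) : ℤ) - ((q * l' + j : ℕ) : ℤ) = q * ((l : ℤ) - l') := by
          push_cast; ring
        rw [h2, abs_mul, Nat.abs_cast]
        nlinarith [(Nat.cast_nonneg q : (0 : ℤ) ≤ q)]
      · exact Or.inl hi
    · exact fun il _ => (hZ _ _).1.min measurable_const
    · intro il _
      refine le_trans ?_ (hZa il.1 (q * il.2 + j))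
      have hZi : Integrable (Z il.1 (q * il.2 + j)) P := (hZ _ _).2.2.1
      exact integral_mono (hZi.inf (integrable_const t)) hZi fun ω => min_le_left _ _
    · intro il _
      refine le_trans (lintegral_mono fun ω => ENNReal.ofReal_le_ofReal (Real.exp_le_exp.2 ?_))
        (hZ il.1 (q * il.2 + j)).2.2.2.2
      have h1 := hY0 il.1 (q * il.2 + j) ω
      have h2 : Y il.1 (q * il.2 + j) ω ≤ Z il.1 (q * il.2 + j) ω := min_le_left _ _
      have h3 := Real.rpow_le_rpow h1 h2 hr.le
      exact mul_le_mul_of_nonneg_left h3 hc₀.le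
    · apply Real.exp_le_exp.2
      have hm0 : (0 : ℝ) < m := by linarith
      have h1 : (m : ℝ) * m ^ (r - 1) = m ^ r := by
        rw [← Real.rpow_one_add' hm0.le (by simpa using hr.ne')]; ring_nf
      have h2 : (1 / (2 * q * L) : ℝ) ^ r * n ^ r ≤ m ^ r := by
        rw [← Real.mul_rpow (by positivity) (by positivity)]
        refine Real.rpow_le_rpow (by positivity) ?_ hr.le
        rw [one_div, inv_mul_le_iff₀ (by positivity)]
        linarith
      simp only [Finset.card_product, Finset.card_range]
      push_cast
      have h3 : c * K * ((1 / (2 * q * L) : ℝ) ^ r * n ^ r) ≤ c * K * (m * m ^ (r - 1)) := by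
        rw [h1]; gcongr
      linarith
  calc _ ≤ P.real (⋃ j ∈ Finset.range q, {ω | ((Finset.range K ×ˢ Finset.range m).card : ℝ) *
        (a₀ + ε) ≤ ∑ il ∈ Finset.range K ×ˢ Finset.range m, Y il.1 (q * il.2 + j) ω}) :=
        measureReal_mono hsub (measure_ne_top _ _)
    _ ≤ ∑ j ∈ Finset.range q, _ := measureReal_biUnion_finset_le _ _
    _ ≤ ∑ j ∈ Finset.range q, _ := Finset.sum_le_sum hj
    _ = _ := by simp

end IIDWeights

end tubes

/-! ### The upper bound: leaving both endpoints along disjoint rays -/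

section rays

variable {d : ℕ}

/-- The orientation of the ray with first step `dir i` along the coordinate axis `a`. -/
def raySign (a : Fin d) (i : Fin d × Bool) : ℤ := if i = (a, false) then -1 else 1

/-- The path that leaves the origin by the step `dir i` and then follows the axis `a`, away from
the origin. For the `2d` values of `i`, these paths only meet at the origin. -/
def ray (a : Fin d) (i : Fin d × Bool) : ℕ → Fin d → ℤ
  | 0 => 0
  | k + 1 => dir i + Pi.single a (raySign a i * k)

lemma abs_raySign (a : Fin d) (i : Fin d × Bool) : |raySign a i| = 1 := by
  unfold raySign; split_ifs <;> simp

lemma adj_ray (a : Fin d) (i : Fin d × Bool) (k : ℕ) :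
    (latticeGraph d).Adj (ray a i k) (ray a i (k + 1)) := by
  cases k with
  | zero => simpa [ray] using adj_add_dir (0 : Fin d → ℤ) i
  | succ k =>
    rw [adj_iff, Finset.sum_eq_single a]
    · simp only [ray, Pi.add_apply, Pi.single_eq_same]
      rw [← abs_raySign a i, ← abs_neg]
      congr 1
      push_cast
      ring
    · intro j _ hj; simp [ray, hj]
    · simp

/-- The edges of a ray. -/
def rayEdge (a : Fin d) (i : Fin d × Bool) (k : ℕ) : Edge d :=
  ⟨s(ray a i k, ray a i (k + 1)), adj_ray a i k⟩

/-- The edges of the rays are distinct; they are told apart by their midpoints. -/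
lemma ray_midpoint_injective (a : Fin d) {i i' : Fin d × Bool} {k k' : ℕ}
    (h : ray a i k + ray a i (k + 1) = ray a i' k' + ray a i' (k' + 1)) : i = i' ∧ k = k' := by
  obtain ⟨j, β⟩ := i
  obtain ⟨j', β'⟩ := i'
  have h1 := congrFun h a
  have h2 := congrFun h j
  have h3 := congrFun h j'
  have hd : ∀ (j c : Fin d) (β : Bool),
      dir (j, β) c = if c = j then (if β then 1 else -1) else 0 := fun j c β => by
    simp [dir, Pi.single_apply]
  have hs : ∀ (j : Fin d) (β : Bool) (k : ℕ),
      raySign a (j, β) * (k : ℤ) = if j = a ∧ β = false then -(k : ℤ) else k := fun j β k => by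
    simp only [raySign, Prod.mk.injEq]; split_ifs <;> simp
  cases k <;> cases k' <;> simp only [ray, Pi.add_apply, Pi.zero_apply, hd, hs,
    Pi.single_apply, Prod.mk.injEq] at h1 h2 h3 ⊢ <;> cases β <;> cases β' <;> grind

lemma abs_ray_midpoint_le (a : Fin d) (i : Fin d × Bool) (k : ℕ) {b : Fin d} (hab : a ≠ b) :
    |(ray a i k + ray a i (k + 1)) b| ≤ 2 := by
  have hd : |dir i b| ≤ 1 := by
    simp only [dir, Pi.single_apply]; split_ifs <;> simp
  rw [abs_le] at hd ⊢
  cases k <;> simp only [ray, Pi.add_apply, Pi.zero_apply, Pi.single_eq_of_ne hab.symm] <;>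
    omega

/-- The edges of the rays at the origin (for `false`) and at `z` (for `true`). -/
def endEdge (a : Fin d) (z : Fin d → ℤ) (g : Bool × (Fin d × Bool) × ℕ) : Edge d :=
  shiftEdge (if g.1 then z else 0) (rayEdge a g.2.1 g.2.2)

lemma endEdge_injective {a b : Fin d} (hab : a ≠ b) {z : Fin d → ℤ} (hz : 2 < |z b|) :
    Function.Injective (endEdge a z) := by
  -- An edge of this family is determined by the sum of its two endpoints.
  let mid : Edge d → Fin d → ℤ := fun e =>
    Sym2.lift ⟨fun u v => u + v, fun u v => add_comm u v⟩ e.1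
  have hmid : ∀ g, mid (endEdge a z g) =
      ray a g.2.1 g.2.2 + ray a g.2.1 (g.2.2 + 1) + 2 • (if g.1 then z else 0) := by
    intro g
    change (ray a g.2.1 g.2.2 + _) + (ray a g.2.1 (g.2.2 + 1) + _) = _
    rw [two_nsmul]
    abel
  rintro ⟨s, i, k⟩ ⟨s', i', k'⟩ h
  have h1 : mid _ = mid _ := congrArg mid h
  rw [hmid, hmid] at h1
  have h2 := congrFun h1 b
  have h3 := abs_ray_midpoint_le a i k hab
  have h4 := abs_ray_midpoint_le a i' k' hab
  rw [abs_le] at h3 h4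
  have hs : s = s' := by
    rcases lt_abs.1 hz with hz | hz <;>
    cases s <;> cases s' <;> simp at h2 h3 h4 ⊢ <;> omega
  subst hs
  obtain ⟨rfl, rfl⟩ := ray_midpoint_injective a (add_right_cancel h1)
  rfl

lemma latticeTime_ray_le {w : Edge d → ℝ} (hw : ∀ e, 0 ≤ w e) (a : Fin d) (i : Fin d × Bool)
    {k R : ℕ} (hk : k ≤ R) :
    latticeTime w 0 (ray a i k) ≤ ∑ l ∈ Finset.range R, w (rayEdge a i l) := by
  calc latticeTime w 0 (ray a i k) ≤ ∑ l ∈ Finset.range k, w (rayEdge a i l) :=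
        (latticeTime_chain hw (ray a i) k).trans
          (Finset.sum_le_sum fun l _ => latticeTime_le_edge hw (adj_ray a i l))
    _ ≤ _ := Finset.sum_le_sum_of_subset_of_nonneg (Finset.range_mono hk) fun _ _ _ => hw _

/-- The passage time from the origin to `z` along a ray to its point `y`, from `y` to `y + z`, and
back along the translated ray to `z`. -/
lemma latticeTime_le_rays {w : Edge d → ℝ} (hw : ∀ e, 0 ≤ w e) (a : Fin d) (i : Fin d × Bool)
    {k R : ℕ} (hk : k ≤ R) (z : Fin d → ℤ) :
    latticeTime w 0 z ≤ latticeTime w (ray a i k) (ray a i k + z) +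
      ∑ g ∈ (Finset.univ : Finset Bool) ×ˢ Finset.range R, w (endEdge a z (g.1, i, g.2)) := by
  have h1 := latticeTime_triangle hw 0 (ray a i k) z
  have h2 := latticeTime_triangle hw (ray a i k) (ray a i k + z) z
  have h3 := latticeTime_ray_le hw a i hk
  have h4 := latticeTime_ray_le (w := fun e => w (shiftEdge z e)) (fun e => hw _) a i hk
  rw [latticeTime_shift hw, latticeTime_comm hw, zero_add] at h4
  rw [Finset.sum_product]
  simp only [Fintype.sum_bool, endEdge, shiftEdge_zero, if_true, Bool.false_eq_true, if_false]
  linarith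

lemma sum_rpow_le {κ : Type*} (s : Finset κ) (f : κ → ℝ) (hf : ∀ i, 0 ≤ f i) {r : ℝ} (hr : 0 < r)
    (hr1 : r ≤ 1) : (∑ i ∈ s, f i) ^ r ≤ ∑ i ∈ s, f i ^ r := by
  classical
  induction s using Finset.induction_on with
  | empty => simp [Real.zero_rpow hr.ne']
  | insert i s hi ih =>
    rw [Finset.sum_insert hi, Finset.sum_insert hi]
    exact (Real.rpow_add_le_add_rpow (hf i) (Finset.sum_nonneg fun j _ => hf j) hr.le hr1).trans
      (by linarith)

end rays

section upper

variable {d : ℕ} {Ω : Type*} [MeasurableSpace Ω] {P : Measure Ω} [IsProbabilityMeasure P]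
  {τ : Edge d → Ω → ℝ} {M : ℝ}

namespace IIDWeights

/-- All `2d` pairs of rays are slow with a probability close to `exp (-2 d c t ^ r)`: the minimum
over the pairs is at most the average, and `t ↦ t ^ r` is subadditive. -/
lemma exists_prob_rays_le (H : IIDWeights P τ M) {r c A : ℝ} (hr : 0 < r) (hr1 : r ≤ 1) (hc : 0 < c)
    (hexp : ∀ e, ∫⁻ ω, ENNReal.ofReal (Real.exp (c * τ e ω ^ r)) ∂P ≤ ENNReal.ofReal A)
    {a b : Fin d} (hab : a ≠ b) (R : ℕ) :
    ∃ C : ℝ, ∀ z : Fin d → ℤ, 2 < |z b| → ∀ t : ℝ, 0 ≤ t →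
      P.real {ω | ∀ i, t < ∑ g ∈ (Finset.univ : Finset Bool) ×ˢ Finset.range R,
        τ (endEdge a z (g.1, i, g.2)) ω} ≤ C * Real.exp (-(2 * d * c * t ^ r)) := by
  set s : Finset (Bool × (Fin d × Bool) × ℕ) :=
    Finset.univ ×ˢ (Finset.univ ×ˢ Finset.range R)
  refine ⟨Real.exp (s.card * Real.log (max A 1)), fun z hz t ht => ?_⟩
  have hinj := endEdge_injective hab hz
  have h := prob_le_sum_le_exp (P := P) H.meas H.indep s (fun g => {endEdge a z g})
    (fun g _ g' _ hne => Set.disjoint_singleton.2 (hinj.ne hne))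
    (fun g ω => c * τ (endEdge a z g) ω ^ r)
    (fun g _ => ((measurable_sigmaOn (Set.mem_singleton _)).pow_const r).const_mul c)
    (b := Real.log (max A 1)) (t := 2 * d * c * t ^ r) (fun g _ => by
      rw [Real.exp_log (by positivity)]
      exact (hexp _).trans (ENNReal.ofReal_le_ofReal (le_max_left _ _)))
  rw [sub_eq_add_neg, Real.exp_add] at h
  refine le_trans (measureReal_mono fun ω hω => ?_) h
  have h1 : ∀ i ∈ (Finset.univ : Finset (Fin d × Bool)), t ^ r ≤
      ∑ g ∈ (Finset.univ : Finset Bool) ×ˢ Finset.range R, τ (endEdge a z (g.1, i, g.2)) ω ^ r :=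
    fun i _ => (Real.rpow_le_rpow ht (hω i).le hr.le).trans
      (sum_rpow_le _ _ (fun g => H.nonneg _ ω) hr hr1)
  have h2 := Finset.card_nsmul_le_sum _ _ _ h1
  have h3 : (Finset.univ : Finset (Fin d × Bool)).card • t ^ r = 2 * d * t ^ r := by
    simp [mul_comm]
  have h4 : ∑ i, ∑ g ∈ (Finset.univ : Finset Bool) ×ˢ Finset.range R,
      τ (endEdge a z (g.1, i, g.2)) ω ^ r = ∑ g ∈ s, τ (endEdge a z g) ω ^ r := by
    simp only [s, Finset.sum_product]
    rw [Finset.sum_comm]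
  rw [h3, h4] at h2
  change 2 * d * c * t ^ r ≤ ∑ g ∈ s, c * τ (endEdge a z g) ω ^ r
  rw [← Finset.mul_sum]
  calc 2 * d * c * t ^ r = c * (2 * d * t ^ r) := by ring
    _ ≤ _ := by gcongr

/-- The upper bound of the large deviation estimate: unless all tubes that start on one of the rays
are slow, the delay `n ξ` has to arise on the rays at the endpoints. -/
lemma prob_le (H : IIDWeights P τ M) (hd : 2 ≤ d) {x : Fin d → ℝ} (hx : x ≠ 0) {α r ξ ρ : ℝ}
    (hr : 0 < r) (hr1 : r ≤ 1) (hα : 0 < α) (hξ : 0 < ξ)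
    (hexp : ∀ c : ℝ, 0 < c → c < α → ∃ A : ℝ, 0 ≤ A ∧ ∀ e,
      ∫⁻ ω, ENNReal.ofReal (Real.exp (c * τ e ω ^ r)) ∂P ≤ ENNReal.ofReal A)
    (hρ : ρ < 2 * d * α * ξ ^ r) :
    ∃ C : ℝ, ∀ᶠ n : ℕ in atTop, P.real {ω | (n : ℝ) * (timeConstant P τ x + ξ) <
        latticeTime (fun e => τ e ω) 0 (latticeFloor ((n : ℝ) • x))} ≤
      C * Real.exp (-ρ * (n : ℝ) ^ r) := by
  set μ := timeConstant P τ x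
  obtain ⟨b, hb⟩ := Function.ne_iff.1 hx
  have : Nontrivial (Fin d) := Fin.nontrivial_iff_two_le.2 hd
  obtain ⟨a, hab⟩ := exists_ne b
  obtain ⟨δ, hδ0, hδ1, hδ⟩ : ∃ δ : ℝ, 0 < δ ∧ δ < 1 ∧
      ρ < 2 * d * ((1 - δ) * α) * ((1 - δ) * ξ) ^ r := by
    have hcont : Tendsto (fun δ : ℝ => 2 * d * ((1 - δ) * α) * ((1 - δ) * ξ) ^ r) (𝓝[>] 0)
        (𝓝 (2 * d * ((1 - 0) * α) * ((1 - 0) * ξ) ^ r)) := by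
      refine Tendsto.mono_left ?_ nhdsWithin_le_nhds
      refine ContinuousAt.tendsto
        (f := fun δ : ℝ => 2 * d * ((1 - δ) * α) * ((1 - δ) * ξ) ^ r) ?_
      refine ContinuousAt.mul (by fun_prop) (ContinuousAt.rpow_const (by fun_prop) ?_)
      left; simpa using hξ.ne'
    simp only [sub_zero, one_mul] at hcont
    have h1 : ∀ᶠ δ : ℝ in 𝓝[>] 0, δ < 1 := nhdsWithin_le_nhds (gt_mem_nhds one_pos)
    obtain ⟨δ, ⟨h2, h3⟩, h4⟩ :=
      (((hcont.eventually (lt_mem_nhds hρ)).and h1).and self_mem_nhdsWithin).exists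
    exact ⟨δ, h4, h3, h2⟩
  set c := (1 - δ) * α
  have hc : 0 < c := mul_pos (by linarith) hα
  have hcα : c < α := by simp only [c]; nlinarith
  obtain ⟨A, hA, hAe⟩ := hexp c hc hcα
  have hε : 0 < δ * ξ / 5 := by positivity
  obtain ⟨c₁, C₁, D, hc₁, hC₁, htube⟩ := H.exists_tubes hr hr1 hc hA hAe hab hb hε
  -- With this many tubes, the event that all of them are slow is negligible.
  obtain ⟨K, hK⟩ := exists_nat_ge (ρ / c₁)
  rw [div_le_iff₀ hc₁] at hK
  obtain ⟨C₂, hrays⟩ := H.exists_prob_rays_le hr hr1 hc hAe hab (K * D + 1)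
  refine ⟨2 * d * C₁ + |C₂|, ?_⟩
  have hzb : ∀ᶠ n : ℕ in atTop, 2 < |latticeFloor ((n : ℝ) • x) b| := by
    have hb' : 0 < |x b| := abs_pos.2 hb
    filter_upwards [(tendsto_natCast_atTop_atTop (R := ℝ)).eventually_ge_atTop (3 / |x b|)]
      with n hn
    rw [div_le_iff₀ hb', ← Nat.abs_cast n, ← abs_mul] at hn
    have h1 := Int.floor_le ((n : ℝ) * x b)
    have h2 := Int.lt_floor_add_one ((n : ℝ) * x b)
    simp only [latticeFloor, Pi.smul_apply, smul_eq_mul]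
    rcases le_abs.1 hn with h | h
    · have : (2 : ℝ) < ⌊(n : ℝ) * x b⌋ := by linarith
      exact lt_abs.2 (Or.inl (by exact_mod_cast this))
    · have : (2 : ℝ) < ((-⌊(n : ℝ) * x b⌋ : ℤ) : ℝ) := by push_cast; linarith
      exact lt_abs.2 (Or.inr (by exact_mod_cast this))
  filter_upwards [htube K, hzb] with n htube hz
  set z := latticeFloor ((n : ℝ) • x)
  set t := (n : ℝ) * ((1 - δ) * ξ)
  have ht : 0 ≤ t := mul_nonneg (Nat.cast_nonneg n) (mul_nonneg (by linarith) hξ.le)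
  have hray : ∀ (i : Fin d × Bool) (k : ℕ), dir i + Pi.single a (raySign a i * k * D) =
      ray a i (k * D + 1) := fun i k => by
    simp only [ray]; push_cast; rw [mul_assoc]
  have hsub : {ω | (n : ℝ) * (μ + ξ) < latticeTime (fun e => τ e ω) 0 z} ⊆
      (⋃ i ∈ (Finset.univ : Finset (Fin d × Bool)), {ω | ∀ k < K, (n : ℝ) * (μ + 5 * (δ * ξ / 5)) <
        latticeTime (fun e => τ e ω) (dir i + Pi.single a (raySign a i * k * D))
          (dir i + Pi.single a (raySign a i * k * D) + z)}) ∪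
      {ω | ∀ i, t < ∑ g ∈ (Finset.univ : Finset Bool) ×ˢ Finset.range (K * D + 1),
        τ (endEdge a z (g.1, i, g.2)) ω} := by
    intro ω hω
    have hω' : (n : ℝ) * (μ + ξ) < latticeTime (fun e => τ e ω) 0 z := hω
    by_contra hcon
    rw [Set.mem_union, not_or] at hcon
    obtain ⟨hcon1, hcon2⟩ := hcon
    apply hcon2
    intro i
    have h1 : ¬ ∀ k < K, (n : ℝ) * (μ + 5 * (δ * ξ / 5)) <
        latticeTime (fun e => τ e ω) (dir i + Pi.single a (raySign a i * k * D))
          (dir i + Pi.single a (raySign a i * k * D) + z) := fun h =>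
      hcon1 (Set.mem_iUnion₂.2 ⟨i, Finset.mem_univ i, h⟩)
    push Not at h1
    obtain ⟨k, hk, h1⟩ := h1
    rw [hray] at h1
    have h2 := latticeTime_le_rays (fun e => H.nonneg e ω) a i
      (show k * D + 1 ≤ K * D + 1 by have := Nat.mul_le_mul_right D hk.le; omega) z
    have h3 : t = n * (μ + ξ) - n * (μ + 5 * (δ * ξ / 5)) := by simp only [t]; ring
    linarith
  have hexp1 : C₁ * Real.exp (-c₁ * K * (n : ℝ) ^ r) ≤ C₁ * Real.exp (-ρ * (n : ℝ) ^ r) := by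
    have := Real.rpow_nonneg (Nat.cast_nonneg (α := ℝ) n) r
    gcongr
    linarith
  have hexp2 : C₂ * Real.exp (-(2 * d * c * t ^ r)) ≤ |C₂| * Real.exp (-ρ * (n : ℝ) ^ r) := by
    have h0 := Real.rpow_nonneg (Nat.cast_nonneg (α := ℝ) n) r
    refine mul_le_mul (le_abs_self _) (Real.exp_le_exp.2 ?_) (Real.exp_pos _).le (abs_nonneg _)
    simp only [t]
    rw [Real.mul_rpow (Nat.cast_nonneg n) (mul_nonneg (by linarith) hξ.le)]
    nlinarith
  calc _ ≤ _ := measureReal_mono hsub (measure_ne_top _ _)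
    _ ≤ _ := measureReal_union_le _ _
    _ ≤ (∑ i : Fin d × Bool, C₁ * Real.exp (-ρ * (n : ℝ) ^ r)) +
        |C₂| * Real.exp (-ρ * (n : ℝ) ^ r) := by
      refine add_le_add ((measureReal_biUnion_finset_le _ _).trans
        (Finset.sum_le_sum fun i _ => ?_)) ((hrays z hz t ht).trans hexp2)
      exact (htube (dir i) (raySign a i) (abs_raySign a i)).trans hexp1
    _ = _ := by
      simp only [Finset.sum_const, Finset.card_univ, Fintype.card_prod, Fintype.card_fin,
        Fintype.card_bool, nsmul_eq_mul]
      push_cast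
      ring

end IIDWeights

end upper

/-! ### The rate of decay, and the moments of the weights -/

section conclusion

/-- Exponential bounds on both sides determine the rate. -/
lemma tendsto_log_of_exp_bounds {p : ℕ → ℝ} {r l : ℝ} (hr : 0 < r)
    (hlow : ∀ ρ, l < ρ → ∃ c : ℝ, 0 < c ∧ ∀ᶠ n : ℕ in atTop,
      c * Real.exp (-ρ * (n : ℝ) ^ r) ≤ p n)
    (hup : ∀ ρ, ρ < l → ∃ C : ℝ, ∀ᶠ n : ℕ in atTop, p n ≤ C * Real.exp (-ρ * (n : ℝ) ^ r)) :
    Tendsto (fun n : ℕ => 1 / (n : ℝ) ^ r * Real.log (p n)) atTop (𝓝 (-l)) := by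
  have hinf : Tendsto (fun n : ℕ => (n : ℝ) ^ r) atTop atTop :=
    (tendsto_rpow_atTop hr).comp tendsto_natCast_atTop_atTop
  have hpos : ∀ᶠ n : ℕ in atTop, 0 < p n := by
    obtain ⟨c, hc, h⟩ := hlow (l + 1) (by linarith)
    filter_upwards [h] with n hn
    exact (by positivity : 0 < c * Real.exp (-(l + 1) * (n : ℝ) ^ r)).trans_le hn
  have hlim : ∀ C ρ : ℝ,
      Tendsto (fun n : ℕ => 1 / (n : ℝ) ^ r * Real.log C - ρ) atTop (𝓝 (-ρ)) := by
    intro C ρ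
    have := ((hinf.inv_tendsto_atTop).mul_const (Real.log C)).sub_const ρ
    simpa using this
  have hlog : ∀ (C ρ : ℝ) (n : ℕ), 0 < C → 0 < (n : ℝ) ^ r →
      1 / (n : ℝ) ^ r * Real.log (C * Real.exp (-ρ * (n : ℝ) ^ r)) =
      1 / (n : ℝ) ^ r * Real.log C - ρ := by
    intro C ρ n hC hn
    rw [Real.log_mul hC.ne' (Real.exp_pos _).ne', Real.log_exp]
    field_simp
    ring
  refine tendsto_order.2 ⟨fun y hy => ?_, fun y hy => ?_⟩
  · obtain ⟨ρ, h1, h2⟩ := exists_between (show l < -y by linarith)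
    obtain ⟨c, hc, h⟩ := hlow ρ h1
    filter_upwards [h, (hlim c ρ).eventually (lt_mem_nhds (show y < -ρ by linarith)),
      hinf.eventually_gt_atTop 0] with n h3 h4 h5
    refine h4.trans_le ?_
    rw [← hlog c ρ n hc h5]
    exact mul_le_mul_of_nonneg_left (Real.log_le_log (by positivity) h3) (by positivity)
  · obtain ⟨ρ, h1, h2⟩ := exists_between (show -y < l by linarith)
    obtain ⟨C, h⟩ := hup ρ h2
    filter_upwards [h, (hlim C ρ).eventually (gt_mem_nhds (show -ρ < y by linarith)),
      hinf.eventually_gt_atTop 0, hpos] with n h3 h4 h5 h6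
    have hC : 0 < C := pos_of_mul_pos_left (h6.trans_le h3) (Real.exp_pos _).le
    refine lt_of_le_of_lt ?_ h4
    rw [← hlog C ρ n hC h5]
    exact mul_le_mul_of_nonneg_left (Real.log_le_log h6 h3) (by positivity)

variable {d : ℕ} {Ω : Type*} [MeasurableSpace Ω] {P : Measure Ω} [IsProbabilityMeasure P]
  {τ : Edge d → Ω → ℝ}

lemma exists_uniform_exp_moment (hmeas : ∀ e, Measurable (τ e)) (hnonneg : ∀ e ω, 0 ≤ τ e ω)
    (hident : ∀ e e', IdentDistrib (τ e) (τ e') P P) {α β r : ℝ} (hβ : 0 < β) (hr : 0 < r)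
    (htail : ∀ e, ∀ t : ℝ, 0 ≤ t → P.real {ω | t < τ e ω} ≤ β * Real.exp (-α * t ^ r)) (c : ℝ)
    (hc : 0 < c) (hcα : c < α) : ∃ A : ℝ, 0 ≤ A ∧ ∀ e,
      ∫⁻ ω, ENNReal.ofReal (Real.exp (c * τ e ω ^ r)) ∂P ≤ ENNReal.ofReal A := by
  rcases isEmpty_or_nonempty (Edge d) with h | ⟨⟨e₀⟩⟩
  · exact ⟨0, le_rfl, fun e => h.elim e⟩
  · have hfin := lintegral_exp_ne_top (hmeas e₀) (hnonneg e₀) hβ hr hc hcα (htail e₀)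
    refine ⟨(∫⁻ ω, ENNReal.ofReal (Real.exp (c * τ e₀ ω ^ r)) ∂P).toReal, ENNReal.toReal_nonneg,
      fun e => ?_⟩
    rw [ENNReal.ofReal_toReal hfin]
    have hm : Measurable fun y : ℝ => ENNReal.ofReal (Real.exp (c * y ^ r)) := by
      have : Measurable fun y : ℝ => c * y ^ r := (measurable_id.pow_const r).const_mul c
      exact (Real.measurable_exp.comp this).ennreal_ofReal
    exact ((hident e e₀).comp hm).lintegral_eq.le

omit [IsProbabilityMeasure P] in
lemma integral_pow_le (hmeas : ∀ e, Measurable (τ e)) (hnonneg : ∀ e ω, 0 ≤ τ e ω) {r c A : ℝ}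
    (hr : 0 < r) (hc : 0 < c) (hA : 0 ≤ A)
    (hexp : ∀ e, ∫⁻ ω, ENNReal.ofReal (Real.exp (c * τ e ω ^ r)) ∂P ≤ ENNReal.ofReal A)
    (k : ℕ) (hk : 0 < k) : ∃ M : ℝ, 0 ≤ M ∧ ∀ e, Integrable (fun ω => τ e ω ^ k) P ∧
      ∫ ω, τ e ω ^ k ∂P ≤ M := by
  obtain ⟨C, hC, hle⟩ := pow_le_exp_rpow hr hc k hk
  refine ⟨C * A, by positivity, fun e => ?_⟩
  have hI : Integrable (fun ω => Real.exp (c * τ e ω ^ r)) P :=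
    integrable_of_lintegral_exp_ne_top (hmeas e)
      (ne_top_of_le_ne_top ENNReal.ofReal_ne_top (hexp e))
  have hIA : ∫ ω, Real.exp (c * τ e ω ^ r) ∂P ≤ A := by
    have := hexp e
    rwa [← ofReal_integral_eq_lintegral_ofReal hI (ae_of_all _ fun ω => (Real.exp_pos _).le),
      ENNReal.ofReal_le_ofReal_iff hA] at this
  have hint : Integrable (fun ω => τ e ω ^ k) P :=
    (hI.const_mul C).mono' ((hmeas e).pow_const k).aestronglyMeasurable (ae_of_all _ fun ω => by
      rw [Real.norm_of_nonneg (pow_nonneg (hnonneg e ω) k)]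
      exact hle _ (hnonneg e ω))
  refine ⟨hint, (integral_mono hint (hI.const_mul C) fun ω => hle _ (hnonneg e ω)).trans ?_⟩
  rw [integral_const_mul]
  gcongr

end conclusion

end FPP

/-- Upper tail large deviations in first passage percolation with Weibull-type tails, `r ≤ 1`.
The first two conjuncts say that the passage times are integrable and that the limit which
defines the time constant `μ(x)` exists; the third is the large deviation limit. -/
theorem theorem1p1 {Ω : Type*} [MeasurableSpace Ω] (P : Measure Ω) [IsProbabilityMeasure P]
    (d : ℕ) (hd : 2 ≤ d)
    (τ : (latticeGraph d).edgeSet → Ω → ℝ)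
    (hmeas : ∀ e, Measurable (τ e))
    (hnonneg : ∀ e ω, 0 ≤ τ e ω)
    (hindep : iIndepFun τ P)
    (hident : ∀ e e', IdentDistrib (τ e) (τ e') P P)
    (β₁ β₂ α r : ℝ) (hβ₁ : 0 < β₁) (hβ₂ : 0 < β₂) (hα : 0 < α) (hr : 0 < r) (hr1 : r ≤ 1)
    (htail : ∀ e, ∀ t : ℝ, 0 ≤ t →
      β₁ * Real.exp (-α * t ^ r) ≤ P.real {ω | t < τ e ω} ∧
      P.real {ω | t < τ e ω} ≤ β₂ * Real.exp (-α * t ^ r))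
    (ξ : ℝ) (hξ : 0 < ξ) (x : Fin d → ℝ) (hx : x ≠ 0) :
    (∀ y : Fin d → ℝ, Integrable (fun ω => passageTime (fun e => τ e ω) 0 y) P) ∧
    Tendsto (fun t : ℝ => t⁻¹ * meanPassageTime P τ (t • x)) atTop (𝓝 (timeConstant P τ x)) ∧
    Tendsto
      (fun n : ℕ => 1 / (n : ℝ) ^ r *
        Real.log (P.real {ω | (n : ℝ) * (timeConstant P τ x + ξ) <
          passageTime (fun e => τ e ω) 0 ((n : ℝ) • x)}))
      atTop (𝓝 (-(2 * d * α * ξ ^ r))) := by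
  obtain ⟨A, hA, hAe⟩ := FPP.exists_uniform_exp_moment hmeas hnonneg hident hβ₂ hr
    (fun e t ht => (htail e t ht).2) (α / 2) (by positivity) (by linarith)
  obtain ⟨M₁, hM₁, hI₁⟩ :=
    FPP.integral_pow_le hmeas hnonneg hr (by positivity) hA hAe 1 one_pos
  obtain ⟨M₂, hM₂, hI₂⟩ :=
    FPP.integral_pow_le hmeas hnonneg hr (by positivity) hA hAe 2 two_pos
  simp only [pow_one] at hI₁
  have H : FPP.IIDWeights P τ (M₁ + M₂) :=
    { meas := hmeas
      nonneg := hnonneg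
      indep := hindep
      ident := hident
      M_nonneg := by positivity
      integrable := fun e => (hI₁ e).1
      integral_le := fun e => (hI₁ e).2.trans (by linarith)
      integrable_sq := fun e => (hI₂ e).1
      integral_sq_le := fun e => (hI₂ e).2.trans (by linarith) }
  refine ⟨fun y => H.integrable_latticeTime _ _, H.tendsto_meanPassageTime x, ?_⟩
  simp only [FPP.passageTime_eq, FPP.latticeFloor_zero]
  refine FPP.tendsto_log_of_exp_bounds hr (fun ρ hρ => ?_) (fun ρ hρ => ?_)
  · exact H.prob_ge hx hβ₁ hξ (fun e t ht => (htail e t ht).1) hρ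
  · exact H.prob_le hd hx hr hr1 hα hξ
      (FPP.exists_uniform_exp_moment hmeas hnonneg hident hβ₂ hr
        fun e t ht => (htail e t ht).2) hρ
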